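/- Let $k$ be an algebraically closed field; a variety over $k$ is an integral separated scheme of finite type over $k$. For a variety $X$ over $k$ and $m\ge 0$ let $X_m$ be the $m$-th jet scheme of $X$, regarded as the set of its $k$-valued points, that is, of the $k$-morphisms $\operatorname{Spec} k[t]/(t^{m+1})\to X$, with the Zariski topology. Let $X_\infty=\varprojlim_m X_m$ be the arc space (again its $k$-valued points), with projections $\psi_m: X_\infty\to X_m$ and $\pi=\psi_0: X_\infty\to X_0=X$. For a closed point $x\in X$ put $$\lambda_m(x)=m\dim X-\dim \psi_m(\pi^{-1}(x)),$$ where the dimension of a subset of $X_m$ is the dimension of its Zariski closure, and let $\lambda(x)=\lim_{m\to\infty}\lambda_m(x)$. Let $X$ and $Y$ be varieties over $k$ with $Y$ smooth over $k$, let $x\in X$ and $y\in Y$ be closed points, and let $(x,y)$ be the corresponding closed point of $X\times_k Y$. Then $$\lambda((x,y))=\lambda(x).$$ More precisely, for every integer $L$, the sequence $\lambda_m((x,y))$ converges to $L$ if and only if the sequence $\lambda_m(x)$ converges to $L$. -/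

import Mathlib

open CategoryTheory CategoryTheory.Limits AlgebraicGeometry Filter Topology

universe u

namespace JetArc

/-- A variety over `k`, given by its structure morphism: an integral, separated scheme of finite
type over `k`. -/
class IsVariety {k : Type u} [Field k] {X : Scheme.{u}} (p : X ⟶ Spec (CommRingCat.of k)) :
    Prop where
  isIntegral : IsIntegral X
  isSeparated : IsSeparated p
  locallyOfFiniteType : LocallyOfFiniteType p
  quasiCompact : QuasiCompact p

/-- The ring `k[t]/(t^(m+1))`. -/
abbrev Trunc (k : Type u) [Field k] (m : ℕ) : Type u :=
  AdjoinRoot ((Polynomial.X : Polynomial k) ^ (m + 1))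

/-- The truncation `k[t]/(t^(m+1)) → k[t]/(t^(n+1))` for `n ≤ m`. -/
noncomputable def truncMap (k : Type u) [Field k] {n m : ℕ} (h : n ≤ m) :
    Trunc k m →ₐ[k] Trunc k n :=
  AdjoinRoot.algHomOfDvd k _ _ (pow_dvd_pow Polynomial.X (Nat.succ_le_succ h))

/-- The coefficient of `t^j` (`j ≤ m`) of an element of `k[t]/(t^(m+1))`: the coefficient of its
representative of degree at most `m`. -/
noncomputable def truncCoeff (k : Type u) [Field k] {m : ℕ} (j : Fin (m + 1)) (a : Trunc k m) : k :=
  (AdjoinRoot.modByMonicHom (Polynomial.monic_X_pow (R := k) (m + 1)) a).coeff j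

section

variable {k : Type u} [Field k] {X : Scheme.{u}} (p : X ⟶ Spec (CommRingCat.of k))

/-- The `k`-valued points of the `m`-th jet scheme of `X`: the `k`-morphisms
`Spec k[t]/(t^(m+1)) ⟶ X`. -/
@[ext]
structure Jet (m : ℕ) where
  /-- the underlying morphism of schemes -/
  hom : Spec (CommRingCat.of (Trunc k m)) ⟶ X
  w : hom ≫ p = Spec.map (CommRingCat.ofHom (algebraMap k (Trunc k m)))

variable {p}

/-- The canonical projection `X_m → X_n` for `n ≤ m`. -/
noncomputable def Jet.trunc {n m : ℕ} (h : n ≤ m) (γ : Jet p m) : Jet p n where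
  hom := Spec.map (CommRingCat.ofHom (truncMap k h).toRingHom) ≫ γ.hom
  w := by
    rw [Category.assoc, γ.w, ← Spec.map_comp, ← CommRingCat.ofHom_comp]
    congr 2
    exact (truncMap k h).comp_algebraMap

/-- The jet `γ` factors through the open subscheme `U`. -/
def Jet.LiesIn {m : ℕ} (γ : Jet p m) (U : X.Opens) : Prop :=
  (⊤ : (Spec (CommRingCat.of (Trunc k m))).Opens) ≤ γ.hom ⁻¹ᵁ U

/-- The pullback `γ^* : 𝒪(U) → k[t]/(t^(m+1))` along a jet which factors through `U`. -/
noncomputable def Jet.pullbackFun {m : ℕ} (γ : Jet p m) {U : X.Opens} (h : γ.LiesIn U) :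
    Γ(X, U) →+* Trunc k m :=
  (γ.hom.appLE U ⊤ h ≫ (Scheme.ΓSpecIso (CommRingCat.of (Trunc k m))).hom).hom

/-- For an open `U` and a polynomial `F` with coefficients in `k` in the variables `a^(j)`
(`a ∈ 𝒪(U)`, `0 ≤ j ≤ m`), the set of the jets `γ` in `U` at which `F` does not vanish when
`a^(j)` is given as value the coefficient of `t^j` in `γ^* a`. -/
def Jet.basicOpen (p : X ⟶ Spec (CommRingCat.of k)) (m : ℕ) (U : X.Opens)
    (F : MvPolynomial (Γ(X, U) × Fin (m + 1)) k) : Set (Jet p m) :=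
  {γ | ∃ h : γ.LiesIn U,
    MvPolynomial.eval (fun q ↦ truncCoeff k q.2 (γ.pullbackFun h q.1)) F ≠ 0}

/-- The Zariski topology on the `k`-valued points of the jet scheme `X_m`. For `U` affine open in
`X`, the jet scheme `U_m` is an affine open subscheme of `X_m`, and its coordinate ring is generated
over `k` by the coordinates `a^(j)`, `a ∈ 𝒪(U)`, `0 ≤ j ≤ m`; so the sets below are the principal
open subsets of the members `U_m` of an affine open cover of `X_m`. -/
instance (m : ℕ) : TopologicalSpace (Jet p m) :=
  TopologicalSpace.generateFrom
    {V | ∃ (U : X.Opens) (F : MvPolynomial (Γ(X, U) × Fin (m + 1)) k),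
      IsAffineOpen U ∧ V = Jet.basicOpen p m U F}

variable (p)

/-- The `k`-valued points of the arc space `X_∞`: the projective limit of the sets of jets. -/
structure Arc where
  /-- the `m`-jet of the arc -/
  jet : ∀ m : ℕ, Jet p m
  compat : ∀ (n m : ℕ) (h : n ≤ m), (jet m).trunc h = jet n

/-- The fibre `π⁻¹(x) ⊆ X_∞` of `π = ψ_0 : X_∞ → X_0 = X` over `x`. A `0`-jet is identified with
the image of the only point of `Spec k[t]/(t)`. -/
def arcFiber (x : X) : Set (Arc p) :=
  {γ | ∀ s : Spec (CommRingCat.of (Trunc k 0)), (γ.jet 0).hom s = x}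

/-- The set `ψ_m(π⁻¹(x)) ⊆ X_m`. -/
def jetImage (x : X) (m : ℕ) : Set (Jet p m) :=
  (fun γ : Arc p ↦ γ.jet m) '' arcFiber p x

end

/-- The dimension of a nonempty space of finite Krull dimension, as a natural number. -/
noncomputable def dim (T : Type*) [TopologicalSpace T] : ℕ :=
  ((topologicalKrullDim T).unbotD 0).toNat

section

variable {k : Type u} [Field k] {X : Scheme.{u}} (p : X ⟶ Spec (CommRingCat.of k))

/-- `λ_m(x) = m · dim X - dim ψ_m(π⁻¹(x))`. The dimension of a (constructible) subset of `X_m` is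
the dimension of its Zariski closure. -/
noncomputable def lambdaSeq (x : X) (m : ℕ) : ℤ :=
  (m : ℤ) * (dim X : ℤ) - (dim (closure (jetImage p x m)) : ℤ)

/-- `λ(x) = L`, in the sense that `λ_m(x)` converges to `L`, that is, `λ_m(x) = L` for all large
enough `m`. -/
def HasLambda (x : X) (L : ℤ) : Prop :=
  Tendsto (lambdaSeq p x) atTop (𝓝 L)

/-- The invariant `λ(x) = lim_{m → ∞} λ_m(x)`. -/
noncomputable def lambda (x : X) : ℤ :=
  limUnder atTop (lambdaSeq p x)

end

end JetArc

/-! The two sequences agree term by term: `lambdaSeq` at $(x,y)$ equals `lambdaSeq` at $x$ for every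
$m$, so nothing about limits is needed. An arc of $X\times Y$ through $(x,y)$ is a pair of arcs
through $x$ and $y$, hence $\psi_m(\pi^{-1}(x,y))$ is the product of $\psi_m(\pi^{-1}(x))$ and
$\psi_m(\pi^{-1}(y))$. Dimensions add, and for smooth $Y$ the second factor has dimension $m\dim Y$,
which cancels the extra term in $m\dim(X\times Y)=m\dim X+m\dim Y$ (`dim_pullback`).

Dimensions of sets of jets are turned into algebra without constructing jet schemes. For a nonempty
set $S$ of jets centred at a closed point $x$ and an affine neighbourhood $U$ of $x$, let `coordAlg`
be the algebra of functions $S\to k$ generated by the coefficients $a^{(j)}$, $a\in\mathcal O(U)$.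
It is of finite type, its $k$-points are exactly the points of the closure of $S$, and the
Nullstellensatz gives $\dim\overline S=\dim$ `coordAlg` (`topologicalKrullDim_closure_eq`).

For a product of families this algebra is the tensor product of the two algebras
(`ringKrullDim_coordAlg_prod`), and Noether normalization makes the dimension additive. On a smooth
variety, étale coordinates $x_1,\dots,x_n$ near $y$ have fixed constant terms and arbitrary higher
coefficients, and they determine the whole jet; so the algebra is a polynomial ring in $nm$
variables (`ringKrullDim_coordAlg_of_etale`). -/

namespace JetArc

open TensorProduct TopologicalSpace

/-! ### Krull dimension of finitely generated algebras over a field. -/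

section KrullDimension

/-- Going up for chains of prime ideals. -/
theorem exists_ltSeries_comap_of_isIntegral {R S : Type*} [CommRing R] [CommRing S] [Algebra R S]
    [Algebra.IsIntegral R S] [FaithfulSMul R S] (l : LTSeries (PrimeSpectrum R)) :
    ∃ l' : LTSeries (PrimeSpectrum S), l'.length = l.length ∧
      l'.last.comap (algebraMap R S) = l.last := by
  induction l using RelSeries.inductionOn' with
  | singleton p =>
    obtain ⟨Q, -, hQ, hp⟩ := Ideal.exists_ideal_over_prime_of_isIntegral (S := S) p.asIdeal ⊥
      (by simp [Ideal.comap_bot_of_injective _ (FaithfulSMul.algebraMap_injective R S)])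
    exact ⟨RelSeries.singleton _ ⟨Q, hQ⟩, rfl, PrimeSpectrum.ext hp⟩
  | snoc l p hlp ih =>
    obtain ⟨l', hl', hlast⟩ := ih
    have hle : l'.last.asIdeal.comap (algebraMap R S) ≤ p.asIdeal := by
      have h : l.last < p := hlp
      rw [← hlast] at h
      exact h.le
    obtain ⟨Q, hQle, hQ, hp⟩ := Ideal.exists_ideal_over_prime_of_isIntegral (S := S) p.asIdeal
      l'.last.asIdeal hle
    have hlt : l'.last < ⟨Q, hQ⟩ := by
      refine lt_of_le_of_ne hQle fun h ↦ ?_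
      have h' : l.last < p := hlp
      refine h'.ne ?_
      rw [← hlast, h]
      exact PrimeSpectrum.ext hp
    exact ⟨l'.snoc ⟨Q, hQ⟩ hlt, by simp [hl'], by simpa using PrimeSpectrum.ext hp⟩

theorem ringKrullDim_eq_of_isIntegral {R S : Type*} [CommRing R] [CommRing S] [Algebra R S]
    [Algebra.IsIntegral R S] [FaithfulSMul R S] : ringKrullDim S = ringKrullDim R := by
  refine le_antisymm ?_ ?_
  · refine Order.krullDim_le_of_strictMono (fun p ↦ p.comap (algebraMap R S)) fun p q hpq ↦ ?_
    exact Ideal.IsIntegral.comap_lt_comap (R := R) (I := p.asIdeal) (J := q.asIdeal) hpq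
  · refine iSup_le fun l ↦ ?_
    obtain ⟨l', hl', -⟩ := exists_ltSeries_comap_of_isIntegral (S := S) l
    rw [← hl']
    exact Order.LTSeries.length_le_krullDim l'

theorem ringKrullDim_eq_of_injective_of_isIntegral {R S : Type*} [CommRing R] [CommRing S]
    (f : R →+* S) (hf : Function.Injective f) (hf' : f.IsIntegral) :
    ringKrullDim S = ringKrullDim R := by
  algebraize [f]
  have : FaithfulSMul R S := (faithfulSMul_iff_algebraMap_injective R S).mpr hf
  exact ringKrullDim_eq_of_isIntegral

theorem ringKrullDim_mvPolynomial_field (k : Type*) [Field k] (ι : Type*) [Finite ι] :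
    ringKrullDim (MvPolynomial ι k) = Nat.card ι := by
  simp [MvPolynomial.ringKrullDim_of_isNoetherianRing, ringKrullDim_eq_zero_of_field]

variable (k : Type*) [Field k]

theorem exists_ringKrullDim_eq_natCast (R : Type*) [CommRing R] [Nontrivial R] [Algebra k R]
    [Algebra.FiniteType k R] : ∃ d : ℕ, ringKrullDim R = d := by
  obtain ⟨s, g, hg, hg'⟩ := exists_integral_inj_algHom_of_fg k R
  refine ⟨s, ?_⟩
  rw [ringKrullDim_eq_of_injective_of_isIntegral g.toRingHom hg hg',
    ringKrullDim_mvPolynomial_field, Nat.card_fin]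

/-- Tensoring two Noether normalizations gives one of the tensor product: injectivity survives by
flatness over $k$, and integrality can be tested on the factors of a pure tensor. -/
theorem ringKrullDim_tensorProduct (R S : Type*) [CommRing R] [Nontrivial R] [Algebra k R]
    [Algebra.FiniteType k R] [CommRing S] [Nontrivial S] [Algebra k S] [Algebra.FiniteType k S] :
    ringKrullDim (R ⊗[k] S) = ringKrullDim R + ringKrullDim S := by
  obtain ⟨s, g, hg, hg'⟩ := exists_integral_inj_algHom_of_fg k R
  obtain ⟨t, h, hh, hh'⟩ := exists_integral_inj_algHom_of_fg k S
  have hinj : Function.Injective (Algebra.TensorProduct.map g h) := by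
    have := Module.Flat.rTensor_preserves_injective_linearMap (M := MvPolynomial (Fin t) k)
      g.toLinearMap hg
    have h2 := Module.Flat.lTensor_preserves_injective_linearMap (M := R) h.toLinearMap hh
    have := h2.comp this
    rw [← LinearMap.coe_comp, LinearMap.lTensor_comp_rTensor] at this
    exact this
  have hint : (Algebra.TensorProduct.map g h).toRingHom.IsIntegral := by
    intro x
    induction x with
    | zero => exact RingHom.isIntegralElem_zero _
    | add x y hx hy => exact RingHom.IsIntegralElem.add _ hx hy
    | tmul x y =>
      have h1 : (Algebra.TensorProduct.map g h).toRingHom.IsIntegralElem (x ⊗ₜ[k] 1) := by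
        obtain ⟨q, hq, hq'⟩ := hg' x
        refine ⟨q.map (Algebra.TensorProduct.includeLeft (R := k) (S := k)
          (B := MvPolynomial (Fin t) k)).toRingHom, hq.map _, ?_⟩
        rw [Polynomial.eval₂_map]
        have := congrArg (Algebra.TensorProduct.includeLeft (R := k) (S := k) (A := R)
          (B := S)).toRingHom hq'
        rw [Polynomial.hom_eval₂, map_zero] at this
        rw [← this]
        congr 1
        ext <;> simp
      have h2 : (Algebra.TensorProduct.map g h).toRingHom.IsIntegralElem (1 ⊗ₜ[k] y) := by
        obtain ⟨q, hq, hq'⟩ := hh' y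
        refine ⟨q.map (Algebra.TensorProduct.includeRight (R := k)
          (A := MvPolynomial (Fin s) k)).toRingHom, hq.map _, ?_⟩
        rw [Polynomial.eval₂_map]
        have := congrArg (Algebra.TensorProduct.includeRight (R := k) (A := R)
          (B := S)).toRingHom hq'
        rw [Polynomial.hom_eval₂, map_zero] at this
        rw [← this]
        congr 1
        ext c
        · simp [Algebra.algebraMap_eq_smul_one, TensorProduct.smul_tmul']
        · simp
      have := RingHom.IsIntegralElem.mul _ h1 h2
      simpa using this
  rw [ringKrullDim_eq_of_injective_of_isIntegral _ hinj hint,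
    ringKrullDim_eq_of_injective_of_isIntegral g.toRingHom hg hg',
    ringKrullDim_eq_of_injective_of_isIntegral h.toRingHom hh hh',
    ringKrullDim_eq_of_ringEquiv ((MvPolynomial.algebraTensorAlgEquiv k
      (MvPolynomial (Fin s) k)).restrictScalars k |>.trans
      (MvPolynomial.sumAlgEquiv k (Fin t) (Fin s)).symm).toRingEquiv,
    ringKrullDim_mvPolynomial_field, ringKrullDim_mvPolynomial_field,
    ringKrullDim_mvPolynomial_field]
  simp [add_comm]

theorem trdeg_eq_of_injective_of_isAlgebraic (R : Type u) (S : Type u) [CommRing R] [IsDomain R]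
    [CommRing S] [IsDomain S] {k : Type u} [Field k] [Algebra k R] [Algebra k S] [Algebra R S]
    [IsScalarTower k R S] [FaithfulSMul R S] [Algebra.IsAlgebraic R S] :
    Algebra.trdeg k S = Algebra.trdeg k R := by
  rw [← trdeg_add_eq k R (A := S), trdeg_eq_zero (R := R), add_zero]

theorem ringKrullDim_eq_toNat_trdeg {k : Type u} [Field k] (R : Type u) [CommRing R] [IsDomain R]
    [Algebra k R] [Algebra.FiniteType k R] :
    ringKrullDim R = (Algebra.trdeg k R).toNat := by
  obtain ⟨s, g, hg, hg'⟩ := exists_integral_inj_algHom_of_fg k R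
  rw [ringKrullDim_eq_of_injective_of_isIntegral g.toRingHom hg hg',
    ringKrullDim_mvPolynomial_field, Nat.card_fin]
  algebraize [g.toRingHom]
  have : FaithfulSMul (MvPolynomial (Fin s) k) R :=
    (faithfulSMul_iff_algebraMap_injective _ _).mpr hg
  have : IsScalarTower k (MvPolynomial (Fin s) k) R := .of_algebraMap_eq' g.comp_algebraMap.symm
  rw [trdeg_eq_of_injective_of_isAlgebraic (MvPolynomial (Fin s) k) R]
  simp

/-- Over the fraction field $K$ of $P$ the algebra $K\otimes_P B$ is finite, hence algebraic, and
flatness embeds $B$ into it. -/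
theorem isAlgebraic_of_etale (P B : Type*) [CommRing P] [IsDomain P] [CommRing B] [Algebra P B]
    [Algebra.Etale P B] : Algebra.IsAlgebraic P B := by
  refine ⟨fun b ↦ ?_⟩
  let K := FractionRing P
  have : Module.Finite K (K ⊗[P] B) := Algebra.FormallyUnramified.finite_of_free K _
  have hflat : Module.Flat P B := inferInstance
  have hinj : Function.Injective (Algebra.TensorProduct.includeRight : B →ₐ[P] K ⊗[P] B) :=
    Algebra.TensorProduct.includeRight_injective (IsFractionRing.injective P K)
  rw [← isAlgebraic_algHom_iff _ hinj, IsFractionRing.isAlgebraic_iff P K (K ⊗[P] B)]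
  exact (Algebra.IsIntegral.isIntegral _).isAlgebraic

theorem faithfulSMul_of_flat (P B : Type*) [CommRing P] [IsDomain P] [CommRing B] [Nontrivial B]
    [Algebra P B] [Module.Flat P B] : FaithfulSMul P B := by
  have : Module.IsTorsionFree P B := inferInstance
  infer_instance

theorem trdeg_of_etale_mvPolynomial {k : Type u} [Field k] {B : Type u} [CommRing B] [IsDomain B]
    [Algebra k B] (n : ℕ) [Algebra (MvPolynomial (Fin n) k) B]
    [IsScalarTower k (MvPolynomial (Fin n) k) B] [Algebra.Etale (MvPolynomial (Fin n) k) B] :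
    Algebra.trdeg k B = n := by
  have := isAlgebraic_of_etale (MvPolynomial (Fin n) k) B
  have := faithfulSMul_of_flat (MvPolynomial (Fin n) k) B
  rw [trdeg_eq_of_injective_of_isAlgebraic (MvPolynomial (Fin n) k) B]
  simp

end KrullDimension

/-! ### Krull dimension of topological spaces. -/

section Topology

/-- Intended for the inclusion of $k$-points into a spectrum: every closed set is recovered as the
closure of its trace on `T`, so taking preimages is injective on irreducible closed sets. -/
theorem topologicalKrullDim_eq_of_isInducing {T X : Type*} [TopologicalSpace T]
    [TopologicalSpace X] {f : T → X} (hf : IsInducing f)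
    (h : ∀ Z : Set X, IsClosed Z → Z ⊆ closure (f '' (f ⁻¹' Z))) :
    topologicalKrullDim T = topologicalKrullDim X := by
  refine le_antisymm hf.topologicalKrullDim_le ?_
  have hcl (Z : Set X) (hZ : IsClosed Z) : closure (f '' (f ⁻¹' Z)) = Z :=
    (closure_minimal (Set.image_preimage_subset f Z) hZ).antisymm (h Z hZ)
  have hirr (Z : IrreducibleCloseds X) : IsIrreducible (f ⁻¹' (Z : Set X)) := by
    have h1 : IsIrreducible (f '' (f ⁻¹' (Z : Set X))) := by
      rw [← isIrreducible_iff_closure, hcl Z Z.isClosed]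
      exact Z.isIrreducible
    refine ⟨Set.image_nonempty.mp h1.1, fun u v hu hv ⟨a, ha, hau⟩ ⟨b, hb, hbv⟩ ↦ ?_⟩
    obtain ⟨u', hu', rfl⟩ := hf.isOpen_iff.mp hu
    obtain ⟨v', hv', rfl⟩ := hf.isOpen_iff.mp hv
    obtain ⟨_, ⟨c, hc, rfl⟩, hcu, hcv⟩ := h1.2 u' v' hu' hv' ⟨f a, ⟨a, ha, rfl⟩, hau⟩
      ⟨f b, ⟨b, hb, rfl⟩, hbv⟩
    exact ⟨c, hc, hcu, hcv⟩
  refine Order.krullDim_le_of_strictMono (fun Z ↦ (⟨f ⁻¹' (Z : Set X), hirr Z,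
    Z.isClosed.preimage hf.continuous⟩ : IrreducibleCloseds T)) ?_
  refine Monotone.strictMono_of_injective (fun Z Z' hZ ↦ Set.preimage_mono (f := f)
    (SetLike.coe_subset_coe.mpr hZ)) fun Z Z' hZ ↦ ?_
  have hZ' : f ⁻¹' (Z : Set X) = f ⁻¹' (Z' : Set X) := congrArg IrreducibleCloseds.carrier hZ
  refine SetLike.coe_injective ?_
  rw [← hcl Z Z.isClosed, hZ', hcl Z' Z'.isClosed]

/-- The coheight of $Z$ involves only closed sets containing $Z$; these all meet any open set
through a point of $Z$, so it can be computed in that open set. -/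
theorem topologicalKrullDim_eq_of_forall_exists_opens {X : Type*} [TopologicalSpace X] [Nonempty X]
    {d : WithBot ℕ∞} (h : ∀ x : X, ∃ U : Opens X, x ∈ U ∧ topologicalKrullDim U = d) :
    topologicalKrullDim X = d := by
  refine le_antisymm ?_ ?_
  · rw [topologicalKrullDim, Order.krullDim_eq_iSup_coheight]
    refine iSup_le fun Z ↦ ?_
    obtain ⟨x, hx⟩ := Z.isIrreducible.nonempty
    obtain ⟨U, hxU, rfl⟩ := h x
    obtain ⟨W, hW⟩ := (IrreducibleCloseds.orderIsoOfIsOpenEmbedding _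
      U.2.isOpenEmbedding_subtypeVal).surjective ⟨Z, ⟨⟨x, hxU⟩, hx⟩⟩
    have hZ : IrreducibleCloseds.map _ U.2.isOpenEmbedding_subtypeVal.continuous W = Z :=
      congrArg Subtype.val hW
    rw [← hZ, U.2.isOpenEmbedding_subtypeVal.coheight_map]
    exact Order.coheight_le_krullDim W
  · obtain ⟨U, -, rfl⟩ := h (Classical.arbitrary X)
    exact topologicalKrullDim_subspace_le X U

end Topology

/-! ### Sections over affine opens, fibre products and the dimension of a variety. -/

section Scheme

variable {k : Type u} [Field k] {X Y : Scheme.{u}} (p : X ⟶ Spec (CommRingCat.of k))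
  (q : Y ⟶ Spec (CommRingCat.of k))

theorem topologicalKrullDim_of_isAffineOpen {U : X.Opens} (hU : IsAffineOpen U) :
    topologicalKrullDim U = ringKrullDim Γ(X, U) := by
  rw [← PrimeSpectrum.topologicalKrullDim_eq_ringKrullDim]
  exact IsHomeomorph.topologicalKrullDim_eq _ (Scheme.homeoOfIso hU.isoSpec).isHomeomorph

/-- The `k`-algebra of the sections of `X` over `U`. -/
def Sections (_p : X ⟶ Spec (CommRingCat.of k)) (U : X.Opens) : Type u := Γ(X, U)

instance (U : X.Opens) : CommRing (Sections p U) := inferInstanceAs (CommRing Γ(X, U))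

theorem le_preimage_top {Z : Scheme.{u}} (f : X ⟶ Z) (U : X.Opens) : U ≤ f ⁻¹ᵁ ⊤ :=
  fun _ _ ↦ trivial

/-- The structure morphism `k → 𝒪(U)`. -/
noncomputable def sectionsBase (U : X.Opens) : CommRingCat.of k ⟶ Γ(X, U) :=
  (Scheme.ΓSpecIso (CommRingCat.of k)).inv ≫ p.appLE ⊤ U (le_preimage_top p U)

noncomputable instance (U : X.Opens) : Algebra k (Sections p U) :=
  RingHom.toAlgebra (S := Sections p U) (sectionsBase p U).hom

theorem sectionsBase_map {U V : X.Opens} (h : U ≤ V) :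
    sectionsBase p V ≫ X.presheaf.map (homOfLE h).op = sectionsBase p U := by
  rw [sectionsBase, Category.assoc, Scheme.Hom.appLE_map, sectionsBase]

theorem finiteType_sections [LocallyOfFiniteType p] {U : X.Opens} (hU : IsAffineOpen U) :
    Algebra.FiniteType k (Sections p U) := by
  have h1 := p.finiteType_appLE (isAffineOpen_top _) hU (le_preimage_top p U)
  have h2 : (sectionsBase p U).hom.FiniteType := by
    rw [sectionsBase, CommRingCat.hom_comp]
    exact h1.comp (RingHom.FiniteType.of_surjective _
      (ConcreteCategory.bijective_of_isIso (Scheme.ΓSpecIso (CommRingCat.of k)).inv).2)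
  exact h2

theorem isPushout_sectionsBase {U : X.Opens} {V : Y.Opens} (hU : IsAffineOpen U)
    (hV : IsAffineOpen V) :
    IsPushout (sectionsBase p U) (sectionsBase q V)
      ((pullback.fst p q).appLE U (pullback.fst p q ⁻¹ᵁ U ⊓ pullback.snd p q ⁻¹ᵁ V) inf_le_left)
      ((pullback.snd p q).appLE V (pullback.fst p q ⁻¹ᵁ U ⊓ pullback.snd p q ⁻¹ᵁ V)
        inf_le_right) := by
  have h := isIso_pushoutSection_of_isAffineOpen (IsPullback.of_hasPullback p q)
    (US := ⊤) (UT := V) (UX := U) (le_preimage_top _ _) (le_preimage_top _ _) rfl (isAffineOpen_top _) hV hU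
  replace h := (isIso_pushoutSection_iff (IsPullback.of_hasPullback p q) (le_preimage_top _ _) (le_preimage_top _ _) rfl).mp h
  exact IsPushout.of_iso h (Scheme.ΓSpecIso (CommRingCat.of k)) (Iso.refl _) (Iso.refl _)
    (Iso.refl _) (by simp [sectionsBase]) (by simp [sectionsBase]) (by simp) (by simp)

theorem exists_sections_tensor_ringEquiv {U : X.Opens} {V : Y.Opens} (hU : IsAffineOpen U)
    (hV : IsAffineOpen V) :
    ∃ e : Sections p U ⊗[k] Sections q V ≃+*
        Γ(pullback p q, pullback.fst p q ⁻¹ᵁ U ⊓ pullback.snd p q ⁻¹ᵁ V),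
      (∀ a, e (a ⊗ₜ 1) = (pullback.fst p q).appLE U _ inf_le_left a) ∧
      (∀ b, e (1 ⊗ₜ b) = (pullback.snd p q).appLE V _ inf_le_right b) := by
  have h := isPushout_sectionsBase p q hU hV
  have h' := CommRingCat.isPushout_tensorProduct k (Sections p U) (Sections q V)
  let e := h'.isoIsPushout _ _ h
  refine ⟨e.commRingCatIsoToRingEquiv, fun a ↦ ?_, fun b ↦ ?_⟩
  · exact congr($(h'.inl_isoIsPushout_hom _ _ h) a)
  · exact congr($(h'.inr_isoIsPushout_hom _ _ h) b)

theorem isAffineOpen_fst_inf_snd {U : X.Opens} {V : Y.Opens} (hU : IsAffineOpen U)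
    (hV : IsAffineOpen V) :
    IsAffineOpen (pullback.fst p q ⁻¹ᵁ U ⊓ pullback.snd p q ⁻¹ᵁ V) := by
  have : IsAffine _ := hU
  have : IsAffine _ := hV
  have : IsAffine _ := isAffineOpen_top (Spec (CommRingCat.of k))
  exact .of_isIso (Scheme.Hom.isPullback_resLE (IsPullback.of_hasPullback p q)
    (US := ⊤) (UT := V) (UX := U) (le_preimage_top _ _) (le_preimage_top _ _) rfl).isoPullback.hom

/-- Both sides equal the transcendence degree of the function field. Having two opens in the
statement records that the dimension does not depend on the chart. -/
theorem ringKrullDim_sections [IsVariety p] {U : X.Opens} (hU : IsAffineOpen U) [Nonempty U]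
    {U' : X.Opens} (hU' : IsAffineOpen U') [Nonempty U'] :
    ringKrullDim (Sections p U) = ((Algebra.trdeg k (Sections p U')).toNat : ℕ) := by
  have := IsVariety.isIntegral p
  have := IsVariety.locallyOfFiniteType (p := p)
  have key (U : X.Opens) (hU : IsAffineOpen U) [Nonempty U] :
      let : Algebra k X.functionField :=
        RingHom.toAlgebra (X.presheaf.germ ⊤ (genericPoint X) trivial |>.hom.comp
          (sectionsBase p ⊤).hom)
      Algebra.trdeg k (Sections p U) = Algebra.trdeg k X.functionField := by
    let : Algebra k X.functionField :=
      RingHom.toAlgebra (X.presheaf.germ ⊤ (genericPoint X) trivial |>.hom.comp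
        (sectionsBase p ⊤).hom)
    let : Algebra (Sections p U) X.functionField :=
      RingHom.toAlgebra (R := Sections p U) (X.germToFunctionField U).hom
    have : IsDomain (Sections p U) := inferInstanceAs (IsDomain Γ(X, U))
    have : IsFractionRing (Sections p U) X.functionField :=
      functionField_isFractionRing_of_isAffineOpen X U hU
    have : IsScalarTower k (Sections p U) X.functionField := by
      refine .of_algebraMap_eq' ?_
      change _ = (X.germToFunctionField U).hom.comp (sectionsBase p U).hom
      rw [← sectionsBase_map p (le_top : U ≤ ⊤), ← CommRingCat.hom_comp, Category.assoc,
        Scheme.germToFunctionField, TopCat.Presheaf.germ_res]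
      rfl
    have : FaithfulSMul (Sections p U) X.functionField :=
      (faithfulSMul_iff_algebraMap_injective _ _).mpr (IsFractionRing.injective _ _)
    have : Algebra.IsAlgebraic (Sections p U) X.functionField :=
      IsLocalization.isAlgebraic _ (nonZeroDivisors (Sections p U))
    exact (trdeg_eq_of_injective_of_isAlgebraic (Sections p U) X.functionField).symm
  have : IsDomain (Sections p U) := inferInstanceAs (IsDomain Γ(X, U))
  have := finiteType_sections p hU
  rw [ringKrullDim_eq_toNat_trdeg (k := k), key U hU, key U' hU']

theorem dim_eq_of_topologicalKrullDim_eq {T : Type*} [TopologicalSpace T] {d : ℕ}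
    (h : topologicalKrullDim T = d) : dim T = d := by
  rw [dim, h]
  rfl

theorem IsVariety.nonempty [IsVariety p] : Nonempty X :=
  have := IsVariety.isIntegral p
  inferInstance

theorem ringKrullDim_sections_eq_dim [IsVariety p] {U : X.Opens} (hU : IsAffineOpen U)
    [Nonempty U] : ringKrullDim (Sections p U) = dim X := by
  have := IsVariety.nonempty p
  rw [ringKrullDim_sections p hU hU, dim_eq_of_topologicalKrullDim_eq (T := X)]
  refine topologicalKrullDim_eq_of_forall_exists_opens fun x ↦ ?_
  obtain ⟨W, hW, hxW, -⟩ := exists_isAffineOpen_mem_and_subset (X := X) (x := x) (U := ⊤) trivial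
  have : Nonempty W := ⟨⟨x, hxW⟩⟩
  exact ⟨W, hxW, (topologicalKrullDim_of_isAffineOpen hW).trans (ringKrullDim_sections p hW hU)⟩

theorem dim_pullback [IsVariety p] [IsVariety q] [Nonempty ↥(pullback p q)] :
    dim ↥(pullback p q) = dim X + dim Y := by
  have := IsVariety.locallyOfFiniteType (p := p)
  have := IsVariety.locallyOfFiniteType (p := q)
  have := IsVariety.isIntegral p
  have := IsVariety.isIntegral q
  refine dim_eq_of_topologicalKrullDim_eq (topologicalKrullDim_eq_of_forall_exists_opens
    fun z ↦ ?_)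
  obtain ⟨U, hU, hxU, -⟩ := exists_isAffineOpen_mem_and_subset (X := X)
    (x := pullback.fst p q z) (U := ⊤) trivial
  obtain ⟨V, hV, hyV, -⟩ := exists_isAffineOpen_mem_and_subset (X := Y)
    (x := pullback.snd p q z) (U := ⊤) trivial
  have : Nonempty U := ⟨⟨_, hxU⟩⟩
  have : Nonempty V := ⟨⟨_, hyV⟩⟩
  refine ⟨pullback.fst p q ⁻¹ᵁ U ⊓ pullback.snd p q ⁻¹ᵁ V, ⟨hxU, hyV⟩, (topologicalKrullDim_of_isAffineOpen
    (isAffineOpen_fst_inf_snd p q hU hV)).trans ?_⟩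
  obtain ⟨e, -⟩ := exists_sections_tensor_ringEquiv p q hU hV
  have := finiteType_sections p hU
  have := finiteType_sections q hV
  have : IsDomain (Sections p U) := inferInstanceAs (IsDomain Γ(X, U))
  have : IsDomain (Sections q V) := inferInstanceAs (IsDomain Γ(Y, V))
  rw [← ringKrullDim_eq_of_ringEquiv e, ringKrullDim_tensorProduct,
    ringKrullDim_sections_eq_dim p hU, ringKrullDim_sections_eq_dim q hV]
  simp

end Scheme

/-! ### Coefficients in $k[t]/(t^{m+1})$. -/

section Trunc

variable {k : Type u} [Field k] {m : ℕ}

theorem truncCoeff_mk (j : Fin (m + 1)) (f : Polynomial k) :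
    truncCoeff k j (AdjoinRoot.mk (Polynomial.X ^ (m + 1)) f) = f.coeff j := by
  rw [truncCoeff, AdjoinRoot.modByMonicHom_mk]
  conv_rhs => rw [← Polynomial.modByMonic_add_div f (Polynomial.X ^ (m + 1))]
  rw [Polynomial.coeff_add, Polynomial.coeff_X_pow_mul', if_neg (by omega), add_zero]

theorem truncCoeff_add (j : Fin (m + 1)) (a b : Trunc k m) :
    truncCoeff k j (a + b) = truncCoeff k j a + truncCoeff k j b := by
  simp [truncCoeff]

theorem truncCoeff_zero (j : Fin (m + 1)) : truncCoeff k j (0 : Trunc k m) = 0 := by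
  simp [truncCoeff]

theorem truncCoeff_mul (j : Fin (m + 1)) (a b : Trunc k m) :
    truncCoeff k j (a * b) = ∑ i : Fin (j + 1), truncCoeff k ⟨i, by omega⟩ a *
      truncCoeff k ⟨j - i, by omega⟩ b := by
  obtain ⟨f, rfl⟩ := AdjoinRoot.mk_surjective a
  obtain ⟨g, rfl⟩ := AdjoinRoot.mk_surjective b
  simp only [← map_mul, truncCoeff_mk]
  rw [Polynomial.coeff_mul, Finset.Nat.sum_antidiagonal_eq_sum_range_succ
    (fun i l ↦ f.coeff i * g.coeff l), Finset.sum_range]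

theorem truncCoeff_algebraMap (j : Fin (m + 1)) (c : k) :
    truncCoeff k j (algebraMap k (Trunc k m) c) = if (j : ℕ) = 0 then c else 0 := by
  have : algebraMap k (Trunc k m) c = AdjoinRoot.mk _ (Polynomial.C c) := rfl
  rw [this, truncCoeff_mk, Polynomial.coeff_C]

theorem trunc_ext {a b : Trunc k m} (h : ∀ j, truncCoeff k j a = truncCoeff k j b) : a = b := by
  obtain ⟨f, rfl⟩ := AdjoinRoot.mk_surjective a
  obtain ⟨g, rfl⟩ := AdjoinRoot.mk_surjective b
  simp only [truncCoeff_mk] at h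
  rw [AdjoinRoot.mk_eq_mk, Polynomial.X_pow_dvd_iff]
  intro d hd
  simpa [sub_eq_zero] using h ⟨d, hd⟩

/-- The element of `k[t]/(t^(m+1))` with prescribed coefficients. -/
noncomputable def truncOf (c : Fin (m + 1) → k) : Trunc k m :=
  AdjoinRoot.mk _ (∑ j : Fin (m + 1), Polynomial.monomial (j : ℕ) (c j))

theorem truncCoeff_truncOf (j : Fin (m + 1)) (c : Fin (m + 1) → k) :
    truncCoeff k j (truncOf c) = c j := by
  rw [truncOf, truncCoeff_mk, Polynomial.finsetSum_coeff]
  simp [Polynomial.coeff_monomial, Fin.val_inj]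

end Trunc

/-! ### Coordinate algebras of families of truncated arcs. -/

section CoordAlg

variable {k : Type u} [Field k] {m : ℕ} {B : Type*} [CommRing B] [Algebra k B] {T : Type*}
  (ev : T → (B →ₐ[k] Trunc k m))

/-- The coordinate function `a^(j)` on a family of truncated arcs. -/
noncomputable def coordFun (a : B) (j : Fin (m + 1)) : T → k := fun t ↦ truncCoeff k j (ev t a)

/-- The algebra generated by the coordinate functions on a family of truncated arcs. -/
noncomputable def coordAlg : Subalgebra k (T → k) :=
  Algebra.adjoin k (Set.range fun q : B × Fin (m + 1) ↦ coordFun ev q.1 q.2)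

variable {ev}

theorem coordFun_mem (a : B) (j : Fin (m + 1)) : coordFun ev a j ∈ coordAlg ev :=
  Algebra.subset_adjoin ⟨(a, j), rfl⟩

theorem coordFun_mul (a b : B) (j : Fin (m + 1)) :
    coordFun ev (a * b) j = ∑ i : Fin (j + 1), coordFun ev a ⟨i, by omega⟩ *
      coordFun ev b ⟨j - i, by omega⟩ := by
  ext t
  simp [coordFun, truncCoeff_mul]

theorem coordFun_add (a b : B) (j : Fin (m + 1)) :
    coordFun ev (a + b) j = coordFun ev a j + coordFun ev b j := by
  ext t
  simp [coordFun, truncCoeff_add]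

theorem coordFun_algebraMap (c : k) (j : Fin (m + 1)) :
    coordFun ev (algebraMap k B c) j = algebraMap k (T → k) (if (j : ℕ) = 0 then c else 0) := by
  ext t
  rw [coordFun, AlgHom.commutes, truncCoeff_algebraMap]
  rfl

theorem mem_coordAlg_iff (f : T → k) : f ∈ coordAlg ev ↔
    ∃ F : MvPolynomial (B × Fin (m + 1)) k,
      f = fun t ↦ MvPolynomial.eval (fun q ↦ truncCoeff k q.2 (ev t q.1)) F := by
  rw [coordAlg, Algebra.adjoin_range_eq_range_aeval]
  have key (F : MvPolynomial (B × Fin (m + 1)) k) :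
      MvPolynomial.aeval (fun q : B × Fin (m + 1) ↦ coordFun ev q.1 q.2) F =
      fun t ↦ MvPolynomial.eval (fun q ↦ truncCoeff k q.2 (ev t q.1)) F := by
    ext t
    have := congr($(MvPolynomial.comp_aeval (R := k)
      (fun q : B × Fin (m + 1) ↦ coordFun ev q.1 q.2) (Pi.evalAlgHom k (fun _ : T ↦ k) t)) F)
    rw [AlgHom.comp_apply] at this
    refine this.trans ?_
    rw [MvPolynomial.aeval_eq_eval]
    rfl
  constructor
  · rintro ⟨F, rfl⟩
    exact ⟨F, key F⟩
  · rintro ⟨F, rfl⟩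
    exact ⟨F, key F⟩

/-- Coefficients of sums and products are polynomials in the coefficients of the terms, so it is
enough to control generators of $B$. This gives finite type and the generation of coordinate
algebras. -/
theorem coordFun_mem_of_adjoin_eq_top {s : Set B} (hs : Algebra.adjoin k s = ⊤)
    {Q : Subalgebra k (T → k)} (h : ∀ a ∈ s, ∀ j, coordFun ev a j ∈ Q) (a : B)
    (j : Fin (m + 1)) : coordFun ev a j ∈ Q := by
  have ha : a ∈ Algebra.adjoin k s := hs ▸ Algebra.mem_top
  induction ha using Algebra.adjoin_induction generalizing j with
  | mem x hx => exact h x hx j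
  | algebraMap c => rw [coordFun_algebraMap]; exact Q.algebraMap_mem _
  | add x y _ _ hx hy => rw [coordFun_add]; exact Q.add_mem (hx j) (hy j)
  | mul x y _ _ hx hy =>
    rw [coordFun_mul]
    exact Q.sum_mem fun i _ ↦ Q.mul_mem (hx _) (hy _)

theorem coordAlg_le_iff {Q : Subalgebra k (T → k)} :
    coordAlg ev ≤ Q ↔ ∀ a j, coordFun ev a j ∈ Q := by
  rw [coordAlg, Algebra.adjoin_le_iff, Set.range_subset_iff]
  exact ⟨fun h a j ↦ h (a, j), fun h q ↦ h q.1 q.2⟩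

instance [Algebra.FiniteType k B] : Algebra.FiniteType k (coordAlg ev) := by
  obtain ⟨s, hs⟩ := Algebra.FiniteType.out (R := k) (A := B)
  rw [← Subalgebra.fg_iff_finiteType]
  have : coordAlg ev = Algebra.adjoin k
      ((fun q : B × Fin (m + 1) ↦ coordFun ev q.1 q.2) '' ((s : Set B) ×ˢ Set.univ)) := by
    refine le_antisymm (coordAlg_le_iff.mpr (coordFun_mem_of_adjoin_eq_top hs fun a ha j ↦
      Algebra.subset_adjoin ⟨(a, j), ⟨ha, trivial⟩, rfl⟩)) (Algebra.adjoin_mono ?_)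
    exact Set.image_subset_range _ _
  rw [this]
  exact Subalgebra.fg_def.mpr ⟨_, (s.finite_toSet.prod Set.finite_univ).image _, rfl⟩

instance [Nonempty T] : Nontrivial (coordAlg ev) := inferInstance

/-- The truncated arc corresponding to a `k`-point of the coordinate algebra. -/
noncomputable def liftHom (φ : coordAlg ev →ₐ[k] k) : B →ₐ[k] Trunc k m := by
  -- The conditions for a ring homomorphism are polynomial identities between the functions
  -- $a^{(j)}$; they hold in `coordAlg`, so `φ` preserves them.
  have hadd (a b : B) (j : Fin (m + 1)) : φ ⟨coordFun ev (a + b) j, coordFun_mem _ _⟩ =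
      φ ⟨coordFun ev a j, coordFun_mem _ _⟩ + φ ⟨coordFun ev b j, coordFun_mem _ _⟩ := by
    rw [← map_add]
    exact congrArg φ (Subtype.ext (coordFun_add a b j))
  have hmul (a b : B) (j : Fin (m + 1)) : φ ⟨coordFun ev (a * b) j, coordFun_mem _ _⟩ =
      ∑ i : Fin (j + 1), φ ⟨coordFun ev a ⟨i, by omega⟩, coordFun_mem _ _⟩ *
        φ ⟨coordFun ev b ⟨j - i, by omega⟩, coordFun_mem _ _⟩ := by
    simp_rw [← map_mul]
    rw [← map_sum]
    refine congrArg φ (Subtype.ext ((coordFun_mul a b j).trans ?_))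
    rw [AddSubmonoidClass.coe_finsetSum]
    rfl
  have hmap (c : k) (j : Fin (m + 1)) :
      φ ⟨coordFun ev (algebraMap k B c) j, coordFun_mem _ _⟩ = if (j : ℕ) = 0 then c else 0 := by
    have : (⟨coordFun ev (algebraMap k B c) j, coordFun_mem _ _⟩ : coordAlg ev) =
        algebraMap k _ (if (j : ℕ) = 0 then c else 0) := Subtype.ext (coordFun_algebraMap c j)
    rw [this, AlgHom.commutes]
    rfl
  have hone (a : k) : truncOf (fun j : Fin (m + 1) ↦ φ ⟨coordFun ev (algebraMap k B a) j,
      coordFun_mem _ _⟩) = algebraMap k (Trunc k m) a :=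
    trunc_ext fun j ↦ by rw [truncCoeff_truncOf, hmap, truncCoeff_algebraMap]
  exact
    { toFun := fun a ↦ truncOf fun j ↦ φ ⟨coordFun ev a j, coordFun_mem _ _⟩
      map_one' := by simpa using hone 1
      map_zero' := by simpa using hone 0
      map_add' := fun a b ↦ trunc_ext fun j ↦ by
        simp only [truncCoeff_truncOf, truncCoeff_add, hadd]
      map_mul' := fun a b ↦ trunc_ext fun j ↦ by
        simp only [truncCoeff_truncOf, truncCoeff_mul, hmul]
      commutes' := hone }

theorem truncCoeff_liftHom (φ : coordAlg ev →ₐ[k] k) (a : B) (j : Fin (m + 1)) :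
    truncCoeff k j (liftHom φ a) = φ ⟨coordFun ev a j, coordFun_mem _ _⟩ :=
  truncCoeff_truncOf _ _

theorem eval_truncCoeff_liftHom (φ : coordAlg ev →ₐ[k] k) (F : MvPolynomial (B × Fin (m + 1)) k)
    (f : coordAlg ev)
    (hf : ∀ t, (f : T → k) t = MvPolynomial.eval (fun q ↦ truncCoeff k q.2 (ev t q.1)) F) :
    MvPolynomial.eval (fun q ↦ truncCoeff k q.2 (liftHom φ q.1)) F = φ f := by
  have h1 (q : B × Fin (m + 1)) : truncCoeff k q.2 (liftHom φ q.1) =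
      φ ⟨coordFun ev q.1 q.2, coordFun_mem _ _⟩ := truncCoeff_liftHom φ q.1 q.2
  simp only [h1]
  have h2 : f = MvPolynomial.aeval
      (fun q : B × Fin (m + 1) ↦ (⟨coordFun ev q.1 q.2, coordFun_mem _ _⟩ : coordAlg ev)) F := by
    ext t
    rw [hf]
    have := congr($(MvPolynomial.comp_aeval (R := k)
      (fun q : B × Fin (m + 1) ↦ (⟨coordFun ev q.1 q.2, coordFun_mem _ _⟩ : coordAlg ev))
      ((Pi.evalAlgHom k (fun _ : T ↦ k) t).comp (coordAlg ev).val)) F)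
    rw [AlgHom.comp_apply] at this
    refine (this.trans ?_).symm
    rw [MvPolynomial.aeval_eq_eval]
    rfl
  rw [h2, ← AlgHom.comp_apply, MvPolynomial.comp_aeval, MvPolynomial.aeval_eq_eval]

theorem ringKrullDim_map_subalgebra {F G : Type*} [CommRing F] [CommRing G] [Algebra k F]
    [Algebra k G] (A : Subalgebra k F) (r : F →ₐ[k] G) (h : ∀ f ∈ A, r f = 0 → f = 0) :
    ringKrullDim (A.map r) = ringKrullDim A := by
  have hinj : Function.Injective (r.comp A.val) := by
    rw [injective_iff_map_eq_zero]
    exact fun f hf ↦ Subtype.ext (h f f.2 hf)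
  have : (r.comp A.val).range = A.map r := by
    rw [AlgHom.range_comp, Subalgebra.range_val]
  rw [← this]
  exact (ringKrullDim_eq_of_ringEquiv (AlgEquiv.ofInjective _ hinj).toRingEquiv).symm

/-- The restriction of functions along a map. -/
def precompHom (k : Type*) [Field k] {S T : Type*} (g : S → T) : (T → k) →ₐ[k] (S → k) where
  toFun f := f ∘ g
  map_one' := rfl
  map_mul' _ _ := rfl
  map_zero' := rfl
  map_add' _ _ := rfl
  commutes' _ := rfl

theorem map_coordAlg {S : Type*} (g : S → T) :
    (coordAlg ev).map (precompHom k g) = coordAlg (ev ∘ g) := by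
  rw [coordAlg, AlgHom.map_adjoin, ← Set.range_comp]
  rfl

theorem ringKrullDim_coordAlg_comp {S : Type*} (g : S → T)
    (h : ∀ f ∈ coordAlg ev, f ∘ g = 0 → f = 0) :
    ringKrullDim (coordAlg (ev ∘ g)) = ringKrullDim (coordAlg ev) := by
  rw [← map_coordAlg, ringKrullDim_map_subalgebra]
  exact h

end CoordAlg

/-! ### Coordinate algebras of products and of freely varying coordinates. -/

section Product

variable {k : Type u} [Field k]

/-- Write $t=\sum a_i\otimes b_i$ with $(b_i)$ a basis of $A'$. For fixed $s$ the function $\sum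
a_i(s)b_i$ vanishes on $S'$, so each $a_i(s)$ is zero. -/
theorem tensorProduct_eq_zero_of_forall_eval {S S' : Type*} (A : Subalgebra k (S → k))
    (A' : Subalgebra k (S' → k)) (t : A ⊗[k] A')
    (h : ∀ s s', Algebra.TensorProduct.productMap
      ((Pi.evalAlgHom k (fun _ : S ↦ k) s).comp A.val)
      ((Pi.evalAlgHom k (fun _ : S' ↦ k) s').comp A'.val) t = 0) : t = 0 := by
  classical
  let b := Module.Basis.ofVectorSpace k A'
  obtain ⟨c, hc⟩ : ∃ c, t = (TensorProduct.equivFinsuppOfBasisRight b).symm c :=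
    ⟨_, (LinearEquiv.symm_apply_apply _ _).symm⟩
  rw [TensorProduct.equivFinsuppOfBasisRight_symm_apply] at hc
  suffices hc0 : c = 0 by rw [hc, hc0, Finsupp.sum_zero_index]
  ext i s
  have hs : c.sum (fun i a ↦ (a : S → k) s • b i) = 0 := by
    ext s'
    have := h s s'
    rw [hc, Finsupp.sum, map_sum] at this
    rw [Finsupp.sum, AddSubmonoidClass.coe_finsetSum, Finset.sum_apply]
    simpa using this
  have hlin := linearIndependent_iff'.mp b.linearIndependent c.support
    (fun i ↦ (c i : S → k) s) hs
  by_cases hi : i ∈ c.support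
  · simpa using hlin i hi
  · simp [Finsupp.notMem_support_iff.mp hi]

variable {m : ℕ} {B C D : Type*} [CommRing B] [Algebra k B] [CommRing C] [Algebra k C] [CommRing D]
  [Algebra k D] {S S' Z : Type*} {ev : S → (B →ₐ[k] Trunc k m)} {ev' : S' → (C →ₐ[k] Trunc k m)}
  {evz : Z → (D →ₐ[k] Trunc k m)}

/-- Pullback along `g` and `g'` identifies the tensor product with `coordAlg evz`: it is injective
because every pair $(s,s')$ is hit, and `hgen` gives the full image. -/
theorem ringKrullDim_coordAlg_prod [Algebra.FiniteType k B] [Algebra.FiniteType k C] [Nonempty S]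
    [Nonempty S'] (g : Z → S) (g' : Z → S') (hg : ∀ s s', ∃ z, g z = s ∧ g' z = s')
    (β : B →ₐ[k] D) (β' : C →ₐ[k] D)
    (hgen : Algebra.adjoin k (Set.range β ∪ Set.range β') = ⊤)
    (h : ∀ z b, evz z (β b) = ev (g z) b) (h' : ∀ z c, evz z (β' c) = ev' (g' z) c) :
    ringKrullDim (coordAlg evz) = ringKrullDim (coordAlg ev) + ringKrullDim (coordAlg ev') := by
  let P := Algebra.TensorProduct.productMap ((precompHom k g).comp (coordAlg ev).val)
    ((precompHom k g').comp (coordAlg ev').val)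
  have hP : Function.Injective P := by
    rw [injective_iff_map_eq_zero]
    intro t ht
    refine tensorProduct_eq_zero_of_forall_eval _ _ t fun s s' ↦ ?_
    obtain ⟨z, rfl, rfl⟩ := hg s s'
    have hz : (Pi.evalAlgHom k (fun _ : Z ↦ k) z).comp P =
        Algebra.TensorProduct.productMap
          ((Pi.evalAlgHom k (fun _ : S ↦ k) (g z)).comp (coordAlg ev).val)
          ((Pi.evalAlgHom k (fun _ : S' ↦ k) (g' z)).comp (coordAlg ev').val) := by
      ext x
      · simp only [P, Algebra.TensorProduct.productMap_left, AlgHom.comp_assoc]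
        rfl
      · simp [P]
        rfl
    rw [← hz, AlgHom.comp_apply, ht, map_zero]
  have hfun (b : B) (j) : coordFun evz (β b) j = precompHom k g (coordFun ev b j) := by
    ext z
    exact congrArg (truncCoeff k j) (h z b)
  have hfun' (c : C) (j) : coordFun evz (β' c) j = precompHom k g' (coordFun ev' c j) := by
    ext z
    exact congrArg (truncCoeff k j) (h' z c)
  have hrange : P.range = coordAlg evz := by
    rw [Algebra.TensorProduct.productMap_range, AlgHom.range_comp, AlgHom.range_comp,
      Subalgebra.range_val, Subalgebra.range_val]
    refine le_antisymm (sup_le ?_ ?_) (coordAlg_le_iff.mpr (coordFun_mem_of_adjoin_eq_top hgen ?_))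
    · rw [Subalgebra.map_le, coordAlg_le_iff]
      intro b j
      rw [Subalgebra.mem_comap, ← hfun]
      exact coordFun_mem _ _
    · rw [Subalgebra.map_le, coordAlg_le_iff]
      intro c j
      rw [Subalgebra.mem_comap, ← hfun']
      exact coordFun_mem _ _
    · rintro _ (⟨b, rfl⟩ | ⟨c, rfl⟩) j
      · rw [hfun]
        exact Algebra.mem_sup_left ⟨_, coordFun_mem b j, rfl⟩
      · rw [hfun']
        exact Algebra.mem_sup_right ⟨_, coordFun_mem c j, rfl⟩
  rw [← hrange, ← ringKrullDim_eq_of_ringEquiv (AlgEquiv.ofInjective P hP).toRingEquiv,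
    ringKrullDim_tensorProduct]

/-- The positive-degree coefficients of the $x_i$ generate the algebra. They take all values
independently, so over an infinite field they satisfy no polynomial relation. -/
theorem ringKrullDim_coordAlg_of_coordinates [Infinite k] {ι : Type*} [Finite ι] (x : ι → B)
    (h0 : ∀ i, ∃ c : k, ∀ s, truncCoeff k 0 (ev s (x i)) = c)
    (hgen : ∀ b, ∃ a ∈ Algebra.adjoin k (Set.range x), ∀ s, ev s b = ev s a)
    (hsurj : ∀ c : ι × Fin m → k, ∃ s, ∀ i (j : Fin m),
      truncCoeff k j.succ (ev s (x i)) = c (i, j)) :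
    ringKrullDim (coordAlg ev) = (Nat.card ι * m : ℕ) := by
  let P : MvPolynomial (ι × Fin m) k →ₐ[k] (S → k) :=
    MvPolynomial.aeval fun q ↦ coordFun ev (x q.1) q.2.succ
  have heval (F : MvPolynomial (ι × Fin m) k) (s : S) :
      P F s = MvPolynomial.eval (fun q ↦ truncCoeff k q.2.succ (ev s (x q.1))) F := by
    have := congr($(MvPolynomial.comp_aeval (R := k)
      (fun q : ι × Fin m ↦ coordFun ev (x q.1) q.2.succ) (Pi.evalAlgHom k (fun _ : S ↦ k) s)) F)
    rw [AlgHom.comp_apply] at this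
    refine this.trans ?_
    rw [MvPolynomial.aeval_eq_eval]
    rfl
  have hP : Function.Injective P := by
    rw [injective_iff_map_eq_zero]
    intro F hF
    refine MvPolynomial.funext fun c ↦ ?_
    obtain ⟨s, hs⟩ := hsurj c
    have := heval F s
    rw [hF] at this
    simp only [hs] at this
    simpa using this.symm
  have hrange : P.range = coordAlg ev := by
    have hx (i : ι) (j : Fin (m + 1)) : coordFun ev (x i) j ∈ P.range := by
      refine Fin.cases ?_ (fun j ↦ ?_) j
      · obtain ⟨c, hc⟩ := h0 i
        have : coordFun ev (x i) 0 = algebraMap k (S → k) c := funext hc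
        rw [this]
        exact P.range.algebraMap_mem c
      · exact ⟨MvPolynomial.X (i, j), by simp [P]⟩
    refine le_antisymm ?_ (coordAlg_le_iff.mpr fun b j ↦ ?_)
    · rw [← Algebra.map_top, ← MvPolynomial.adjoin_range_X, AlgHom.map_adjoin, Algebra.adjoin_le_iff]
      rintro _ ⟨_, ⟨q, rfl⟩, rfl⟩
      simpa [P] using coordFun_mem (ev := ev) (x q.1) q.2.succ
    · obtain ⟨a, ha, hab⟩ := hgen b
      have hba : coordFun ev b j = coordFun ev a j :=
        funext fun s ↦ congrArg (truncCoeff k j) (hab s)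
      rw [hba]
      have hval : coordFun ev a j = coordFun
          (fun s ↦ (ev s).comp (Algebra.adjoin k (Set.range x)).val) ⟨a, ha⟩ j := rfl
      rw [hval]
      refine coordFun_mem_of_adjoin_eq_top (s := ((↑) : Algebra.adjoin k (Set.range x) → B) ⁻¹'
        Set.range x) Algebra.adjoin_adjoin_coe_preimage ?_ _ j
      rintro ⟨_, _⟩ ⟨i, rfl⟩ j
      exact hx i j
  rw [← hrange, ← ringKrullDim_eq_of_ringEquiv (AlgEquiv.ofInjective P hP).toRingEquiv,
    ringKrullDim_mvPolynomial_field, Nat.card_prod, Nat.card_fin]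

end Product

/-! ### Spaces of $k$-points and the Nullstellensatz. -/

section Jacobson

variable {k : Type u} [Field k] [IsAlgClosed k]

theorem exists_algHom_ker_eq (A : Type*) [CommRing A] [Algebra k A] [Algebra.FiniteType k A]
    (M : Ideal A) [M.IsMaximal] : ∃ φ : A →ₐ[k] k, RingHom.ker φ = M := by
  let := Ideal.Quotient.field M
  have : Module.Finite k (A ⧸ M) := finite_of_finite_type_of_isJacobsonRing k (A ⧸ M)
  have hb := IsAlgClosed.algebraMap_bijective_of_isIntegral (k := k) (K := A ⧸ M)
  let e : k ≃ₐ[k] A ⧸ M := AlgEquiv.ofBijective (Algebra.ofId k (A ⧸ M)) hb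
  refine ⟨e.symm.toAlgHom.comp (Ideal.Quotient.mkₐ k M), ?_⟩
  ext a
  simp [RingHom.mem_ker, Ideal.Quotient.eq_zero_iff_mem]

/-- Send $t$ to the kernel of evaluation at $t$. `hopen` and `hbasis` make the topology of $T$ the
induced one, and `hpoint` puts every maximal ideal in the image; these are dense in each closed set
because $A$ is Jacobson. -/
theorem topologicalKrullDim_eq_ringKrullDim_subalgebra {T : Type*} [TopologicalSpace T]
    (A : Subalgebra k (T → k)) [Algebra.FiniteType k A]
    (hopen : ∀ f ∈ A, IsOpen {t | f t ≠ 0})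
    (hbasis : ∀ O : Set T, IsOpen O → ∀ t ∈ O, ∃ f ∈ A, f t ≠ 0 ∧ ∀ s, f s ≠ 0 → s ∈ O)
    (hpoint : ∀ φ : A →ₐ[k] k, ∃ t, ∀ f : A, φ f = (f : T → k) t) :
    topologicalKrullDim T = ringKrullDim A := by
  let ι : T → PrimeSpectrum A := fun t ↦
    ⟨RingHom.ker ((Pi.evalAlgHom k (fun _ : T ↦ k) t).comp A.val), RingHom.ker_isPrime _⟩
  have hι (t : T) (f : A) : f ∈ (ι t).asIdeal ↔ (f : T → k) t = 0 := Iff.rfl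
  have hind : IsInducing ι := by
    refine ⟨le_antisymm (continuous_iff_le_induced.mp ?_) fun O hO ↦ ?_⟩
    · refine PrimeSpectrum.isTopologicalBasis_basic_opens.continuous_iff.mpr ?_
      rintro _ ⟨f, rfl⟩
      exact hopen f f.2
    · refine (@isOpen_iff_forall_mem_open _ (.induced ι inferInstance) _).mpr fun t ht ↦ ?_
      obtain ⟨f, hf, hft, hfO⟩ := hbasis O hO t ht
      refine ⟨ι ⁻¹' (PrimeSpectrum.basicOpen (⟨f, hf⟩ : A) : Set (PrimeSpectrum A)),
        fun s hs ↦ hfO s ?_, ⟨_, (PrimeSpectrum.basicOpen _).2, rfl⟩, ?_⟩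
      · exact fun h ↦ hs ((hι s ⟨f, hf⟩).mpr h)
      · exact fun h ↦ hft ((hι t ⟨f, hf⟩).mp h)
  rw [← PrimeSpectrum.topologicalKrullDim_eq_ringKrullDim]
  refine topologicalKrullDim_eq_of_isInducing hind fun Z hZ ↦ ?_
  have : IsJacobsonRing A := isJacobsonRing_of_finiteType (A := k)
  refine (JacobsonSpace.closure_inter_closedPoints hZ).symm.subset.trans (closure_mono ?_)
  rintro M ⟨hM, hM'⟩
  have : M.asIdeal.IsMaximal := (PrimeSpectrum.isClosed_singleton_iff_isMaximal M).mp hM'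
  obtain ⟨φ, hφ⟩ := exists_algHom_ker_eq (k := k) A M.asIdeal
  obtain ⟨t, ht⟩ := hpoint φ
  have hM : ι t = M := by
    ext f
    rw [hι, ← ht, ← hφ, RingHom.mem_ker]
  exact ⟨t, by simpa [hM], hM⟩

end Jacobson

/-! ### The local ring $k[t]/(t^{m+1})$ and its one-point spectrum. -/

section TruncLocal

variable {k : Type u} [Field k] {m : ℕ}

/-- The constant coefficient, as a homomorphism. -/
noncomputable def truncResidue (k : Type u) [Field k] (m : ℕ) : Trunc k m →ₐ[k] k where
  toFun := truncCoeff k 0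
  map_one' := (truncCoeff_algebraMap (k := k) (m := m) 0 1).trans (if_pos rfl)
  map_mul' a b := by
    rw [truncCoeff_mul]
    exact Fintype.sum_unique (ι := Fin 1) (fun _ ↦ truncCoeff k 0 a * truncCoeff k 0 b)
  map_zero' := truncCoeff_zero _
  map_add' := truncCoeff_add _
  commutes' c := (truncCoeff_algebraMap 0 c).trans (if_pos rfl)

theorem truncResidue_apply (a : Trunc k m) : truncResidue k m a = truncCoeff k 0 a := rfl

theorem pow_eq_zero_of_truncCoeff_zero {a : Trunc k m} (h : truncCoeff k 0 a = 0) :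
    a ^ (m + 1) = 0 := by
  obtain ⟨f, rfl⟩ := AdjoinRoot.mk_surjective a
  rw [truncCoeff_mk, Fin.val_zero, ← Polynomial.X_dvd_iff] at h
  rw [← map_pow, AdjoinRoot.mk_eq_zero]
  exact pow_dvd_pow_of_dvd h _

theorem isUnit_trunc_iff {a : Trunc k m} : IsUnit a ↔ truncCoeff k 0 a ≠ 0 := by
  constructor
  · intro h
    exact (h.map (truncResidue k m)).ne_zero
  · intro h
    have h0 : truncCoeff k 0 (algebraMap k _ (truncCoeff k 0 a) - a) = 0 := by
      rw [← truncResidue_apply, map_sub, AlgHom.commutes]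
      exact sub_self _
    have hn : IsNilpotent (algebraMap k _ (truncCoeff k 0 a) - a) :=
      ⟨_, pow_eq_zero_of_truncCoeff_zero h0⟩
    have hu : IsUnit (algebraMap k (Trunc k m) (truncCoeff k 0 a)) := (IsUnit.mk0 _ h).map _
    simpa using IsNilpotent.isUnit_add_left_of_commute hn.neg hu (Commute.all _ _)

instance : Nontrivial (Trunc k m) := (truncResidue k m).toRingHom.domain_nontrivial

instance : Subsingleton ↥(Spec (CommRingCat.of (Trunc k m))) := by
  suffices h : ∀ P : PrimeSpectrum (Trunc k m), P.asIdeal = RingHom.ker (truncResidue k m) from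
    ⟨fun P Q ↦ PrimeSpectrum.ext ((h P).trans (h Q).symm)⟩
  intro P
  ext a
  rw [RingHom.mem_ker, truncResidue_apply]
  constructor
  · intro ha
    by_contra h
    exact P.isPrime.ne_top (P.asIdeal.eq_top_of_isUnit_mem ha (isUnit_trunc_iff.mpr h))
  · intro h
    refine P.isPrime.mem_of_pow_mem (m + 1) ?_
    rw [pow_eq_zero_of_truncCoeff_zero h]
    exact P.asIdeal.zero_mem

/-- The only point of `Spec k[t]/(t^(m+1))`. -/
noncomputable def truncPoint (k : Type u) [Field k] (m : ℕ) :
    ↥(Spec (CommRingCat.of (Trunc k m))) :=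
  Classical.choice (inferInstanceAs (Nonempty (PrimeSpectrum (Trunc k m))))

theorem truncMap_mk {n m : ℕ} (h : n ≤ m) (f : Polynomial k) :
    truncMap k h (AdjoinRoot.mk _ f) = AdjoinRoot.mk _ f := by
  refine Eq.trans ?_ (AdjoinRoot.aeval_eq f)
  rfl

theorem truncCoeff_truncMap {n m : ℕ} (h : n ≤ m) (a : Trunc k m) (j : Fin (n + 1)) :
    truncCoeff k j (truncMap k h a) = truncCoeff k ⟨j, by omega⟩ a := by
  obtain ⟨f, rfl⟩ := AdjoinRoot.mk_surjective a
  rw [truncMap_mk, truncCoeff_mk, truncCoeff_mk]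

end TruncLocal

/-! ### Pullback of sections along morphisms from a spectrum. -/

section SpecPullback

variable {R : CommRingCat.{u}} {X : Scheme.{u}}

/-- The pullback of sections along a morphism from a spectrum which factors through `U`. -/
noncomputable def specPullback (f : Spec R ⟶ X) (U : X.Opens) (e : ⊤ ≤ f ⁻¹ᵁ U) : Γ(X, U) ⟶ R :=
  f.appLE U ⊤ e ≫ (Scheme.ΓSpecIso R).hom

theorem specPullback_map (f : Spec R ⟶ X) {U V : X.Opens} (h : U ≤ V) (e : ⊤ ≤ f ⁻¹ᵁ U)
    (e' : ⊤ ≤ f ⁻¹ᵁ V) :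
    X.presheaf.map (homOfLE h).op ≫ specPullback f U e = specPullback f V e' := by
  rw [specPullback, specPullback, ← Category.assoc, Scheme.Hom.map_appLE]

theorem appLE_comp_specPullback {Z : Scheme.{u}} (f : Spec R ⟶ X) (g : X ⟶ Z) {U : X.Opens}
    {W : Z.Opens} (h : U ≤ g ⁻¹ᵁ W) (e : ⊤ ≤ f ⁻¹ᵁ U) (e' : ⊤ ≤ (f ≫ g) ⁻¹ᵁ W) :
    g.appLE W U h ≫ specPullback f U e = specPullback (f ≫ g) W e' := by
  rw [specPullback, specPullback, ← Category.assoc, Scheme.Hom.appLE_comp_appLE]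

theorem specPullback_specMap {S : CommRingCat.{u}} (φ : S ⟶ R) (e : ⊤ ≤ Spec.map φ ⁻¹ᵁ ⊤) :
    specPullback (Spec.map φ) ⊤ e = (Scheme.ΓSpecIso S).hom ≫ φ := by
  rw [specPullback, ← Scheme.ΓSpecIso_naturality]
  congr 1

theorem specPullback_specMap_comp {S : CommRingCat.{u}} (φ : S ⟶ R) (f : Spec S ⟶ X) (U : X.Opens)
    (e : ⊤ ≤ f ⁻¹ᵁ U) (e' : ⊤ ≤ (Spec.map φ ≫ f) ⁻¹ᵁ U) :
    specPullback (Spec.map φ ≫ f) U e' = specPullback f U e ≫ φ := by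
  rw [← appLE_comp_specPullback (Spec.map φ) f e (le_preimage_top _ _), specPullback_specMap, specPullback,
    Category.assoc]

theorem specPullback_fromSpec {U : X.Opens} (hU : IsAffineOpen U) (e : ⊤ ≤ hU.fromSpec ⁻¹ᵁ U) :
    specPullback hU.fromSpec U e = 𝟙 Γ(X, U) := by
  rw [specPullback, Scheme.Hom.appLE, hU.fromSpec_app_self, Category.assoc, Category.assoc,
    ← Category.assoc ((Spec Γ(X, U)).presheaf.map _), ← Functor.map_comp, Iso.inv_comp_eq]
  exact (congrArg (· ≫ _) ((Spec Γ(X, U)).presheaf.map_id _)).trans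
    ((Category.id_comp _).trans (Category.comp_id _).symm)

theorem specPullback_congr {f g : Spec R ⟶ X} (h : f = g) (U : X.Opens) (e : ⊤ ≤ f ⁻¹ᵁ U)
    (e' : ⊤ ≤ g ⁻¹ᵁ U) : specPullback f U e = specPullback g U e' := by
  subst h
  rfl

theorem mem_basicOpen_of_isUnit_specPullback (f : Spec R ⟶ X) {U : X.Opens} (e : ⊤ ≤ f ⁻¹ᵁ U)
    (g : Γ(X, U)) (h : IsUnit (specPullback f U e g)) (s : ↥(Spec R)) :
    f s ∈ X.basicOpen g := by
  have h' : IsUnit (f.appLE U ⊤ e g) := by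
    have := h.map (Scheme.ΓSpecIso R).inv.hom
    simpa [specPullback] using this
  have h2 := Scheme.basicOpen_of_isUnit _ h'
  rw [Scheme.basicOpen_appLE] at h2
  have h3 : s ∈ (⊤ : (Spec R).Opens) := trivial
  rw [← h2] at h3
  exact h3.2

theorem sectionsBase_comp_specPullback {k : Type u} [Field k] (p : X ⟶ Spec (CommRingCat.of k))
    (f : Spec R ⟶ X) (φ : CommRingCat.of k ⟶ R) (hf : f ≫ p = Spec.map φ) (U : X.Opens)
    (e : ⊤ ≤ f ⁻¹ᵁ U) : sectionsBase p U ≫ specPullback f U e = φ := by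
  rw [sectionsBase, Category.assoc, appLE_comp_specPullback f p _ e (le_preimage_top _ _),
    Iso.inv_comp_eq, specPullback_congr hf _ _ (le_preimage_top _ _), specPullback_specMap]

theorem fromSpec_comp_structure {k : Type u} [Field k] (p : X ⟶ Spec (CommRingCat.of k))
    {U : X.Opens} (hU : IsAffineOpen U) : hU.fromSpec ≫ p = Spec.map (sectionsBase p U) := by
  rw [← IsAffineOpen.SpecMap_appLE_fromSpec p (isAffineOpen_top _) hU (le_preimage_top p U),
    IsAffineOpen.fromSpec_top, Scheme.isoSpec_Spec_inv, ← Spec.map_comp]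
  rfl

end SpecPullback

/-! ### Jets, their centres, and homomorphisms out of affine coordinate rings. -/

section Jets

variable {k : Type u} [Field k] {X : Scheme.{u}} {p : X ⟶ Spec (CommRingCat.of k)} {m : ℕ}

/-- The point at which a jet is centred. -/
noncomputable def Jet.center (γ : Jet p m) : X := γ.hom (truncPoint k m)

theorem Jet.hom_apply (γ : Jet p m) (s : ↥(Spec (CommRingCat.of (Trunc k m)))) :
    γ.hom s = γ.center := by
  rw [Jet.center, Subsingleton.elim s]

theorem Jet.liesIn_iff {γ : Jet p m} {U : X.Opens} : γ.LiesIn U ↔ γ.center ∈ U :=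
  ⟨fun h ↦ h (x := truncPoint k m) trivial, fun h s _ ↦ by
    change γ.hom s ∈ U
    rwa [γ.hom_apply]⟩

theorem Jet.center_trunc {n : ℕ} (h : n ≤ m) (γ : Jet p m) : (γ.trunc h).center = γ.center :=
  γ.hom_apply _

theorem Jet.pullbackFun_map (γ : Jet p m) {U V : X.Opens} (hUV : U ≤ V) (hU : γ.LiesIn U)
    (hV : γ.LiesIn V) (a : Γ(X, V)) :
    γ.pullbackFun hU (X.presheaf.map (homOfLE hUV).op a) = γ.pullbackFun hV a :=
  congr($(specPullback_map γ.hom hUV hU hV) a)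

theorem Jet.pullbackFun_sectionsBase (γ : Jet p m) {U : X.Opens} (hU : γ.LiesIn U) (c : k) :
    γ.pullbackFun hU ((sectionsBase p U).hom c) = algebraMap k (Trunc k m) c :=
  congr($(sectionsBase_comp_specPullback p γ.hom _ γ.w U hU) c)

/-- The pullback of sections along a jet, as a homomorphism of `k`-algebras. -/
noncomputable def Jet.pullbackHom (γ : Jet p m) {U : X.Opens} (hU : γ.LiesIn U) :
    Sections p U →ₐ[k] Trunc k m where
  __ := (γ.pullbackFun hU : Γ(X, U) →+* Trunc k m)
  commutes' c := γ.pullbackFun_sectionsBase hU c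

theorem Jet.center_mem_basicOpen_iff (γ : Jet p m) {U : X.Opens} (hU : γ.LiesIn U) (g : Γ(X, U)) :
    γ.center ∈ X.basicOpen g ↔ truncCoeff k 0 (γ.pullbackFun hU g) ≠ 0 := by
  rw [← isUnit_trunc_iff]
  constructor
  · intro h
    have hg := γ.pullbackFun_map (X.basicOpen_le g) (Jet.liesIn_iff.mpr h) hU g
    rw [← hg]
    exact (X.toRingedSpace.isUnit_res_basicOpen g).map _
  · exact fun h ↦ mem_basicOpen_of_isUnit_specPullback γ.hom hU g h _

/-- The constant term of the pullback of $g$ is the unique $c\in k$ for which $g-c$ is not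
invertible at the centre, so only the centre matters. -/
theorem Jet.truncCoeff_zero_eq_of_center_eq {n : ℕ} {γ : Jet p m} {δ : Jet p n}
    (hγδ : γ.center = δ.center) {U : X.Opens} (hγ : γ.LiesIn U) (hδ : δ.LiesIn U) (g : Γ(X, U)) :
    truncCoeff k 0 (γ.pullbackFun hγ g) = truncCoeff k 0 (δ.pullbackFun hδ g) := by
  have key : ∀ {n : ℕ} (δ : Jet p n) (hδ : δ.LiesIn U) (c : k),
      δ.center ∉ X.basicOpen (g - (sectionsBase p U).hom c : Γ(X, U)) ↔
        truncCoeff k 0 (δ.pullbackFun hδ g) = c := by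
    intro n δ hδ c
    rw [δ.center_mem_basicOpen_iff hδ, not_not, map_sub, δ.pullbackFun_sectionsBase hδ,
      ← truncResidue_apply, map_sub, AlgHom.commutes, sub_eq_zero]
    rfl
  rw [← key γ hγ, hγδ]
  exact (key δ hδ _).mpr rfl

/-- A homomorphism from a ring of sections, as a morphism of commutative rings. -/
noncomputable def homOfSections {U : X.Opens} (φ : Sections p U →ₐ[k] Trunc k m) :
    Γ(X, U) ⟶ CommRingCat.of (Trunc k m) :=
  CommRingCat.ofHom (R := Sections p U) φ.toRingHom

/-- The jet corresponding to a homomorphism from the coordinate ring of an affine open. -/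
noncomputable def Jet.ofHom {U : X.Opens} (hU : IsAffineOpen U) (φ : Sections p U →ₐ[k] Trunc k m) :
    Jet p m where
  hom := Spec.map (homOfSections φ) ≫ hU.fromSpec
  w := by
    rw [Category.assoc, fromSpec_comp_structure, ← Spec.map_comp]
    congr 1
    ext c
    exact φ.commutes c

theorem Jet.ofHom_liesIn {U : X.Opens} (hU : IsAffineOpen U) (φ : Sections p U →ₐ[k] Trunc k m) :
    (Jet.ofHom hU φ).LiesIn U := by
  intro s _
  have : (Jet.ofHom hU φ).hom s ∈ Set.range hU.fromSpec := by
    rw [Jet.ofHom, Scheme.Hom.comp_apply]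
    exact ⟨_, rfl⟩
  rwa [hU.range_fromSpec] at this

theorem Jet.pullbackFun_ofHom {U : X.Opens} (hU : IsAffineOpen U)
    (φ : Sections p U →ₐ[k] Trunc k m) (h : (Jet.ofHom hU φ).LiesIn U) (a : Γ(X, U)) :
    (Jet.ofHom hU φ).pullbackFun h a = φ a := by
  have h' : ⊤ ≤ hU.fromSpec ⁻¹ᵁ U := by rw [hU.fromSpec_preimage_self]
  have key : specPullback (Spec.map (homOfSections φ) ≫ hU.fromSpec) U h = homOfSections φ :=
    (specPullback_specMap_comp (homOfSections φ) _ U h' h).trans (by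
      rw [specPullback_fromSpec, Category.id_comp])
  exact congr($key a)

theorem Jet.trunc_ofHom {n : ℕ} (h : n ≤ m) {U : X.Opens} (hU : IsAffineOpen U)
    (φ : Sections p U →ₐ[k] Trunc k m) :
    (Jet.ofHom hU φ).trunc h = Jet.ofHom hU ((truncMap k h).comp φ) := by
  ext1
  refine (Category.assoc _ _ _).symm.trans (congrArg (· ≫ hU.fromSpec) ?_)
  exact (Spec.map_comp _ _).symm

end Jets

/-! ### Jets centred at a fixed point. -/

section Fibre

variable {k : Type u} [Field k] {X : Scheme.{u}} (p : X ⟶ Spec (CommRingCat.of k)) (m : ℕ)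

/-- The set of the jets which are centred at `x`. -/
def jetsAt (x : X) : Set (Jet p m) := {γ | γ.center = x}

variable {p m}

theorem liesIn_of_mem_jetsAt {x : X} {γ : Jet p m} (hγ : γ ∈ jetsAt p m x) {U : X.Opens}
    (hxU : x ∈ U) : γ.LiesIn U :=
  Jet.liesIn_iff.mpr (by rwa [show γ.center = x from hγ])

theorem isOpen_basicOpen {U : X.Opens} (hU : IsAffineOpen U)
    (F : MvPolynomial (Γ(X, U) × Fin (m + 1)) k) : IsOpen (Jet.basicOpen p m U F) :=
  GenerateOpen.basic _ ⟨U, F, hU, rfl⟩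

theorem isClosed_jetsAt {x : X} (hx : IsClosed ({x} : Set X)) : IsClosed (jetsAt p m x) := by
  rw [← isOpen_compl_iff, isOpen_iff_forall_mem_open]
  intro γ hγ
  obtain ⟨W, hW, hxW, hWx⟩ := exists_isAffineOpen_mem_and_subset
    (U := ⟨{x}ᶜ, hx.isOpen_compl⟩) (show γ.center ∈ _ from hγ)
  -- With $F=1$ the basic open set consists of all jets in $W$.
  refine ⟨Jet.basicOpen p m W 1, ?_, isOpen_basicOpen hW 1, ⟨Jet.liesIn_iff.mpr hxW, by simp⟩⟩
  rintro δ ⟨hδ, -⟩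
  exact hWx (Jet.liesIn_iff.mp hδ)

/-- On the jets centred at a point of `U`, the sections over `V` induce no more functions than the
sections over the affine open `U`. -/
theorem exists_pullbackFun_eq {x : X} {U V : X.Opens} (hU : IsAffineOpen U) (hxU : x ∈ U)
    (hxV : x ∈ V) (b : Γ(X, V)) : ∃ a : Γ(X, U), ∀ γ (hγ : γ ∈ jetsAt p m x),
      γ.pullbackFun (liesIn_of_mem_jetsAt hγ hxV) b =
        γ.pullbackFun (liesIn_of_mem_jetsAt hγ hxU) a := by
  -- A reference jet is needed to define the value `c` of `f₀` at $x$ as an element of $k$.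
  rcases (jetsAt p m x).eq_empty_or_nonempty with h0 | ⟨γ₀, hγ₀⟩
  · exact ⟨0, fun γ hγ ↦ by simp [h0] at hγ⟩
  obtain ⟨f₀, hfV, hxf⟩ := hU.exists_basicOpen_le (V := V) ⟨x, hxV⟩ hxU
  have := hU.isLocalization_basicOpen f₀
  obtain ⟨n, a, ha⟩ := IsLocalization.Away.surj f₀ (X.presheaf.map (homOfLE hfV).op b)
  let c := truncCoeff k 0 (γ₀.pullbackFun (liesIn_of_mem_jetsAt hγ₀ hxU) f₀)
  have hc : c ≠ 0 := (γ₀.center_mem_basicOpen_iff _ f₀).mp (by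
    rwa [show γ₀.center = x from hγ₀])
  let f : Sections p U := f₀
  -- On every jet centred at $x$ the section `f` has constant term `c`, so `g` pulls back to a
  -- nilpotent element. The geometric series `e` is therefore one section over `U` that inverts `f`
  -- on all these jets at once.
  let g : Sections p U := 1 - algebraMap k (Sections p U) c⁻¹ * f
  let e : Sections p U := algebraMap k _ c⁻¹ * ∑ i ∈ Finset.range (m + 1), g ^ i
  let a' : Sections p U := a
  refine ⟨(a' * e ^ n : Sections p U), fun γ hγ ↦ ?_⟩
  have hγU := liesIn_of_mem_jetsAt hγ hxU
  have hγV := liesIn_of_mem_jetsAt hγ hxV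
  have hγf := liesIn_of_mem_jetsAt hγ hxf
  let ψ := γ.pullbackHom hγU
  have hcoeff : truncCoeff k 0 (ψ f) = c :=
    Jet.truncCoeff_zero_eq_of_center_eq (hγ.trans hγ₀.symm) _ _ _
  have hψg : ψ g ^ (m + 1) = 0 := by
    refine pow_eq_zero_of_truncCoeff_zero ?_
    rw [← truncResidue_apply]
    simp only [g, map_sub, map_one, map_mul, AlgHom.commutes]
    rw [truncResidue_apply, hcoeff]
    simp [hc]
  have hef : ψ e * ψ f = 1 := by
    have hf : f = algebraMap k _ c * (1 - g) := by
      simp only [g, sub_sub_cancel, ← mul_assoc, ← map_mul]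
      rw [mul_inv_cancel₀ hc, map_one, one_mul]
    have : e * f = 1 - g ^ (m + 1) := by
      rw [hf]
      simp only [e]
      rw [mul_mul_mul_comm, ← map_mul, inv_mul_cancel₀ hc, map_one, one_mul, geom_sum_mul_neg]
    rw [← map_mul, this, map_sub, map_one, map_pow, hψg, sub_zero]
  have hb : γ.pullbackFun hγV b * ψ f ^ n = ψ a' := by
    have := congrArg (γ.pullbackFun hγf) ha
    rw [map_mul, map_pow, γ.pullbackFun_map hfV hγf hγV] at this
    refine Eq.trans ?_ (this.trans (γ.pullbackFun_map (X.basicOpen_le f₀) hγf hγU a))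
    exact congrArg (fun r ↦ γ.pullbackFun hγV b * r ^ n)
      (γ.pullbackFun_map (X.basicOpen_le f₀) hγf hγU f₀).symm
  have h1 : γ.pullbackFun hγU (a' * e ^ n : Sections p U) = ψ a' * ψ e ^ n := by
    rw [← map_pow, ← map_mul]
    rfl
  rw [h1, ← hb, mul_assoc, ← mul_pow, mul_comm (ψ f), hef, one_pow, mul_one]

end Fibre

/-! ### The Zariski topology on jets at a closed point, and dimensions of closures. -/

section FibreTopology

variable {k : Type u} [Field k] {X : Scheme.{u}} {p : X ⟶ Spec (CommRingCat.of k)} {m : ℕ}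

/-- The pullbacks of the sections over `U` along the jets which are centred at a point of `U`. -/
noncomputable def jetEval {x : X} {U : X.Opens} (hxU : x ∈ U) (γ : jetsAt p m x) :
    Sections p U →ₐ[k] Trunc k m :=
  γ.1.pullbackHom (liesIn_of_mem_jetsAt γ.2 hxU)

theorem mem_basicOpen_iff {x : X} {U : X.Opens} (hxU : x ∈ U) (γ : jetsAt p m x)
    (F : MvPolynomial (Sections p U × Fin (m + 1)) k) :
    γ.1 ∈ Jet.basicOpen p m U F ↔
      MvPolynomial.eval (fun q ↦ truncCoeff k q.2 (jetEval hxU γ q.1)) F ≠ 0 :=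
  ⟨fun ⟨_, h⟩ ↦ h, fun h ↦ ⟨_, h⟩⟩

/-- The topology is generated from all affine opens; on jets centred at $x$ the single chart `U`
suffices, because sections over any other chart can be replaced by sections over `U`. -/
theorem exists_basicOpen_subset {x : X} {U : X.Opens} (hU : IsAffineOpen U) (hxU : x ∈ U)
    {O : Set (Jet p m)} (hO : IsOpen O) (γ : jetsAt p m x) (hγO : γ.1 ∈ O) :
    ∃ F : MvPolynomial (Sections p U × Fin (m + 1)) k, γ.1 ∈ Jet.basicOpen p m U F ∧
      ∀ δ : jetsAt p m x, δ.1 ∈ Jet.basicOpen p m U F → δ.1 ∈ O := by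
  induction hO with
  | basic O hO =>
    obtain ⟨V, F, hV, rfl⟩ := hO
    obtain ⟨hγV, hγF⟩ := hγO
    have hxV : x ∈ V := by
      rw [← show γ.1.center = x from γ.2]
      exact Jet.liesIn_iff.mp hγV
    choose a ha using exists_pullbackFun_eq (p := p) (m := m) hU hxU hxV
    let a' : Γ(X, V) → Sections p U := a
    have key (δ : jetsAt p m x) (hδV : δ.1.LiesIn V) :
        MvPolynomial.eval (fun q ↦ truncCoeff k q.2 (jetEval hxU δ q.1))
          (MvPolynomial.rename (Prod.map a' id) F) =
        MvPolynomial.eval (fun q ↦ truncCoeff k q.2 (δ.1.pullbackFun hδV q.1)) F := by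
      rw [MvPolynomial.eval_rename]
      congr 2
      ext q
      exact congrArg (truncCoeff k q.2) (ha q.1 δ.1 δ.2).symm
    refine ⟨MvPolynomial.rename (Prod.map a' id) F, ?_, fun δ hδ ↦ ?_⟩
    · rw [mem_basicOpen_iff hxU, key γ hγV]
      exact hγF
    · have hδV := liesIn_of_mem_jetsAt δ.2 hxV
      rw [mem_basicOpen_iff hxU, key δ hδV] at hδ
      exact ⟨hδV, hδ⟩
  | univ => exact ⟨1, by rw [mem_basicOpen_iff hxU]; simp, fun _ _ ↦ trivial⟩
  | inter O O' _ _ ih ih' =>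
    obtain ⟨F, hF, hFO⟩ := ih hγO.1
    obtain ⟨F', hF', hFO'⟩ := ih' hγO.2
    rw [mem_basicOpen_iff hxU] at hF hF'
    refine ⟨F * F', ?_, fun δ hδ ↦ ?_⟩
    · rw [mem_basicOpen_iff hxU, map_mul]
      exact mul_ne_zero hF hF'
    · rw [mem_basicOpen_iff hxU, map_mul] at hδ
      exact ⟨hFO δ ((mem_basicOpen_iff hxU δ F).mpr (left_ne_zero_of_mul hδ)),
        hFO' δ ((mem_basicOpen_iff hxU δ F').mpr (right_ne_zero_of_mul hδ))⟩
  | sUnion S _ ih =>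
    obtain ⟨O, hO, hγ⟩ := hγO
    obtain ⟨F, hF, hFO⟩ := ih O hO hγ
    exact ⟨F, hF, fun δ hδ ↦ ⟨O, hO, hFO δ hδ⟩⟩

/-- Otherwise some $f\in\mathcal O(U)$ vanishes at $x$ but not at the new centre. Then $f^{(0)}$ is
the zero function on the family, so `φ` kills it, a contradiction. -/
theorem center_ofHom_eq {x : X} (hx : IsClosed ({x} : Set X)) {U : X.Opens} (hU : IsAffineOpen U)
    (hxU : x ∈ U) {T : Type*} (g : T → jetsAt p m x)
    (φ : coordAlg (jetEval hxU ∘ g) →ₐ[k] k) : (Jet.ofHom hU (liftHom φ)).center = x := by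
  by_contra hne
  let γ := Jet.ofHom hU (liftHom φ)
  have hγU : γ.LiesIn U := Jet.ofHom_liesIn hU _
  obtain ⟨f, hf, hγf⟩ := hU.exists_basicOpen_le (V := ⟨{x}ᶜ, hx.isOpen_compl⟩)
    ⟨γ.center, hne⟩ (Jet.liesIn_iff.mp hγU)
  have hxf : x ∉ X.basicOpen f := fun h ↦ hf h rfl
  refine (γ.center_mem_basicOpen_iff hγU f).mp hγf ?_
  have h1 : γ.pullbackFun hγU f = liftHom φ f := Jet.pullbackFun_ofHom hU _ _ f
  have h2 : coordFun (jetEval hxU ∘ g) f 0 = 0 := by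
    ext t
    by_contra h
    refine hxf ?_
    have := ((g t).1.center_mem_basicOpen_iff (liesIn_of_mem_jetsAt (g t).2 hxU) f).mpr h
    rwa [show (g t).1.center = x from (g t).2] at this
  refine (congrArg (truncCoeff k 0) h1).trans ((truncCoeff_liftHom φ f 0).trans ?_)
  exact (congrArg φ (Subtype.ext h2)).trans (map_zero φ)

/-- The dimension of the closure of a set of jets which are centred at a closed point. -/
theorem topologicalKrullDim_closure_eq [IsAlgClosed k] [LocallyOfFiniteType p] {x : X}
    (hx : IsClosed ({x} : Set X)) {U : X.Opens} (hU : IsAffineOpen U) (hxU : x ∈ U)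
    {S : Set (Jet p m)} (hS : S ⊆ jetsAt p m x) (hS' : S.Nonempty) :
    topologicalKrullDim (closure S) =
      ringKrullDim (coordAlg (fun s : S ↦ jetEval hxU ⟨s.1, hS s.2⟩)) := by
  have hcl : closure S ⊆ jetsAt p m x := closure_minimal hS (isClosed_jetsAt hx)
  let g : closure S → jetsAt p m x := fun t ↦ ⟨t.1, hcl t.2⟩
  have : Nonempty (closure S) := hS'.closure.to_subtype
  have := finiteType_sections p hU
  have hmem (t : closure S) (F : MvPolynomial (Sections p U × Fin (m + 1)) k) :
      t.1 ∈ Jet.basicOpen p m U F ↔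
        MvPolynomial.eval (fun q ↦ truncCoeff k q.2 ((jetEval hxU ∘ g) t q.1)) F ≠ 0 :=
    mem_basicOpen_iff hxU (g t) F
  have hopen : ∀ f ∈ coordAlg (jetEval hxU ∘ g), IsOpen {t | f t ≠ 0} := by
    intro f hf
    obtain ⟨F, rfl⟩ := (mem_coordAlg_iff f).mp hf
    simp_rw [← hmem]
    exact (isOpen_basicOpen hU F).preimage continuous_subtype_val
  have hdense : Dense {t : closure S | t.1 ∈ S} := by
    intro t
    rw [closure_subtype]
    refine closure_mono ?_ t.2
    intro s hs
    exact ⟨⟨s, subset_closure hs⟩, hs, rfl⟩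
  -- Nonvanishing loci are open and $S$ is dense in its closure, so restricting functions to $S$
  -- loses nothing.
  have h1 := ringKrullDim_coordAlg_comp (ev := jetEval hxU ∘ g)
    (fun s : S ↦ (⟨s.1, subset_closure s.2⟩ : closure S)) (by
      intro f hf h0
      by_contra hne
      obtain ⟨t, ht⟩ := Function.ne_iff.mp hne
      obtain ⟨s, hs, hsS⟩ := hdense.inter_open_nonempty _ (hopen f hf) ⟨t, ht⟩
      exact hs (congrFun h0 ⟨s.1, hsS⟩))
  refine Eq.trans ?_ h1.symm
  refine topologicalKrullDim_eq_ringKrullDim_subalgebra _ hopen ?_ ?_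
  · rintro _ ⟨O, hO, rfl⟩ t ht
    obtain ⟨F, hF, hFO⟩ := exists_basicOpen_subset hU hxU hO (g t) ht
    exact ⟨_, (mem_coordAlg_iff _).mpr ⟨F, rfl⟩, (hmem t F).mp hF,
      fun s hs ↦ hFO (g s) ((hmem s F).mpr hs)⟩
  · intro φ
    let γ : jetsAt p m x := ⟨Jet.ofHom hU (liftHom φ), center_ofHom_eq hx hU hxU g φ⟩
    have hγ : jetEval hxU γ = liftHom φ := by
      ext1 a
      exact Jet.pullbackFun_ofHom hU (liftHom φ) _ a
    have heval (F : MvPolynomial (Sections p U × Fin (m + 1)) k)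
        (f : coordAlg (jetEval hxU ∘ g)) (hf : (f : closure S → k) =
          fun t ↦ MvPolynomial.eval (fun q ↦ truncCoeff k q.2 ((jetEval hxU ∘ g) t q.1)) F) :
        MvPolynomial.eval (fun q ↦ truncCoeff k q.2 (jetEval hxU γ q.1)) F = φ f := by
      rw [hγ]
      exact eval_truncCoeff_liftHom φ F f fun t ↦ congrFun hf t
    -- A jet outside the closure is separated from it by some $F$ that vanishes on the closure; as a
    -- function this $F$ is $0$, so its value at `γ`, computed by `φ`, is $0$ as well.
    have hγS : γ.1 ∈ closure S := by
      by_contra hγS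
      obtain ⟨F, hF, hFO⟩ := exists_basicOpen_subset hU hxU isClosed_closure.isOpen_compl γ hγS
      refine (mem_basicOpen_iff hxU γ F).mp hF ?_
      rw [heval F 0, map_zero]
      ext t
      by_contra h
      exact hFO (g t) ((hmem t F).mpr (Ne.symm h)) t.2
    refine ⟨⟨γ.1, hγS⟩, fun f ↦ ?_⟩
    obtain ⟨F, hF⟩ := (mem_coordAlg_iff _).mp f.2
    rw [← heval F f hF, hF]
    rfl

end FibreTopology

/-! ### Infinitesimal lifting for ring homomorphisms. -/

section EtaleLift

variable {P B R C : Type*} [CommRing P] [CommRing B] [Algebra P B] [CommRing R] [CommRing C]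

theorem exists_lift_of_formallySmooth [Algebra.FormallySmooth P B] {r : R →+* C}
    (hr : Function.Surjective r) (hn : IsNilpotent (RingHom.ker r)) (f : P →+* R) (e : B →+* C)
    (h : r.comp f = e.comp (algebraMap P B)) :
    ∃ g : B →+* R, g.comp (algebraMap P B) = f ∧ r.comp g = e := by
  let := f.toAlgebra
  let := (e.comp (algebraMap P B)).toAlgebra
  let e' : B →ₐ[P] C := { e with commutes' := fun _ ↦ rfl }
  let r' : R →ₐ[P] C := { r with commutes' := fun a ↦ congr($h a) }
  let g := Algebra.FormallySmooth.liftOfSurjective e' r' hr hn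
  refine ⟨g.toRingHom, RingHom.ext fun a ↦ g.commutes a, RingHom.ext fun b ↦ ?_⟩
  exact Algebra.FormallySmooth.liftOfSurjective_apply e' r' hr hn b

theorem lift_unique_of_formallyUnramified [Algebra.FormallyUnramified P B] {r : R →+* C}
    (hn : IsNilpotent (RingHom.ker r)) {g₁ g₂ : B →+* R}
    (h : g₁.comp (algebraMap P B) = g₂.comp (algebraMap P B)) (h' : r.comp g₁ = r.comp g₂) :
    g₁ = g₂ := by
  let := (g₁.comp (algebraMap P B)).toAlgebra
  let g₁' : B →ₐ[P] R := { g₁ with commutes' := fun _ ↦ rfl }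
  let g₂' : B →ₐ[P] R := { g₂ with commutes' := fun a ↦ congr($h.symm a) }
  have := Algebra.FormallyUnramified.ext' r hn g₁' g₂' fun b ↦ congr($h' b)
  exact congr(AlgHom.toRingHom $this)

end EtaleLift

/-! ### Truncated arcs in étale coordinates. -/

section EtaleCoordinates

variable {k : Type u} [Field k]

theorem isNilpotent_ker_truncResidue (m : ℕ) :
    IsNilpotent (RingHom.ker (truncResidue k m : Trunc k m →+* k)) := by
  refine ⟨m + 1, ?_⟩
  have h : RingHom.ker (truncResidue k m : Trunc k m →+* k) ≤
      Ideal.span {AdjoinRoot.root (Polynomial.X ^ (m + 1))} := by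
    intro a ha
    obtain ⟨f, rfl⟩ := AdjoinRoot.mk_surjective a
    have h0 : f.coeff 0 = 0 := (truncCoeff_mk 0 f).symm.trans ha
    rw [Ideal.mem_span_singleton, ← AdjoinRoot.mk_X]
    exact map_dvd _ (Polynomial.X_dvd_iff.mpr h0)
  refine le_bot_iff.mp ((Ideal.pow_right_mono h _).trans ?_)
  rw [Ideal.span_singleton_pow, ← AdjoinRoot.mk_X, ← map_pow, AdjoinRoot.mk_self]
  simp

theorem truncResidue_surjective (m : ℕ) : Function.Surjective (truncResidue k m : Trunc k m →+* k) :=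
  fun c ↦ ⟨algebraMap k _ c, (truncResidue k m).commutes c⟩

variable {B : Type u} [CommRing B] [Algebra k B] {n : ℕ} [Algebra (MvPolynomial (Fin n) k) B]
  [IsScalarTower k (MvPolynomial (Fin n) k) B]

theorem exists_truncated_arc [Algebra.FormallySmooth (MvPolynomial (Fin n) k) B] (ε : B →ₐ[k] k)
    (m : ℕ) (c : Fin n → Trunc k m)
    (hc : ∀ i, truncCoeff k 0 (c i) = ε (algebraMap (MvPolynomial (Fin n) k) B (.X i))) :
    ∃ φ : B →ₐ[k] Trunc k m, (∀ i, φ (algebraMap (MvPolynomial (Fin n) k) B (.X i)) = c i) ∧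
      ∀ b, truncCoeff k 0 (φ b) = ε b := by
  obtain ⟨g, hg, hg'⟩ := exists_lift_of_formallySmooth (P := MvPolynomial (Fin n) k)
    (truncResidue_surjective m) (isNilpotent_ker_truncResidue m)
    (MvPolynomial.aeval c : MvPolynomial (Fin n) k →ₐ[k] Trunc k m).toRingHom (ε : B →+* k) (by
      refine MvPolynomial.ringHom_ext (fun a ↦ ?_) fun i ↦ ?_
      · have : algebraMap (MvPolynomial (Fin n) k) B (.C a) = algebraMap k B a :=
          (IsScalarTower.algebraMap_apply k (MvPolynomial (Fin n) k) B a).symm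
        simp [this, -AdjoinRoot.algebraMap_eq]
      · exact (congrArg (truncResidue k m) (MvPolynomial.aeval_X c i)).trans (hc i))
  refine ⟨{ g with commutes' := fun a ↦ ?_ }, fun i ↦ ?_, fun b ↦ congr($hg' b)⟩
  · rw [IsScalarTower.algebraMap_apply k (MvPolynomial (Fin n) k) B]
    exact congr($hg (.C a)).trans (MvPolynomial.aeval_C _ _)
  · exact congr($hg (.X i)).trans (MvPolynomial.aeval_X _ _)

theorem truncated_arc_unique [Algebra.FormallyUnramified (MvPolynomial (Fin n) k) B] {m : ℕ}
    {φ ψ : B →ₐ[k] Trunc k m} (h : ∀ i, φ (algebraMap (MvPolynomial (Fin n) k) B (.X i)) =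
      ψ (algebraMap (MvPolynomial (Fin n) k) B (.X i)))
    (h' : ∀ b, truncCoeff k 0 (φ b) = truncCoeff k 0 (ψ b)) : φ = ψ := by
  have := lift_unique_of_formallyUnramified (P := MvPolynomial (Fin n) k) (g₁ := φ.toRingHom)
    (g₂ := ψ.toRingHom) (isNilpotent_ker_truncResidue m) (by
      refine MvPolynomial.ringHom_ext (fun a ↦ ?_) fun i ↦ h i
      have : algebraMap (MvPolynomial (Fin n) k) B (.C a) = algebraMap k B a :=
        (IsScalarTower.algebraMap_apply k (MvPolynomial (Fin n) k) B a).symm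
      simp [this, -AdjoinRoot.algebraMap_eq]) (RingHom.ext h')
  exact AlgHom.coe_ringHom_injective this

/-- An étale map does not change infinitesimal neighbourhoods. With $\mathfrak m$ the kernel of
$P\to k$, formal smoothness lifts $\varepsilon$ to $B\to P/\mathfrak m^N$, and by unramifiedness
every truncated arc at $\varepsilon$ factors through this lift; $F$ represents the image of $b$. -/
theorem exists_polynomial_truncated_arc_eq [Algebra.Etale (MvPolynomial (Fin n) k) B]
    (ε : B →ₐ[k] k) (m : ℕ) (b : B) : ∃ F : MvPolynomial (Fin n) k, ∀ φ : B →ₐ[k] Trunc k m,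
      (∀ b, truncCoeff k 0 (φ b) = ε b) → φ b = φ (algebraMap _ B F) := by
  let P := MvPolynomial (Fin n) k
  let e : P →+* k := (ε : B →+* k).comp (algebraMap P B)
  have he : Function.Surjective e := fun c ↦ ⟨.C c, by
    have : algebraMap P B (.C c) = algebraMap k B c :=
      (IsScalarTower.algebraMap_apply k P B c).symm
    simp [e, this]⟩
  obtain ⟨N, hN⟩ := isNilpotent_ker_truncResidue (k := k) m
  let I := RingHom.ker e ^ N
  have hI : ∀ a ∈ I, e a = 0 ∨ N = 0 := by
    intro a ha
    rcases Nat.eq_zero_or_pos N with h | h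
    · exact .inr h
    · exact .inl (Ideal.pow_le_self h.ne' ha)
  have hN0 : N ≠ 0 := by
    rintro rfl
    exact one_ne_zero hN
  let r : P ⧸ I →+* k := Ideal.Quotient.lift I e fun a ha ↦ (hI a ha).resolve_right hN0
  have hr : Function.Surjective r := Ideal.Quotient.lift_surjective_of_surjective _ _ he
  have hn : IsNilpotent (RingHom.ker r) := by
    refine ⟨N, ?_⟩
    rw [show RingHom.ker r = _ from Ideal.ker_quotient_lift e _, ← Ideal.map_pow, Ideal.map_quotient_self]
    rfl
  obtain ⟨s, hs, hs'⟩ := exists_lift_of_formallySmooth (P := P) hr hn (Ideal.Quotient.mk I)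
    (ε : B →+* k) (RingHom.ext fun _ ↦ rfl)
  obtain ⟨F, hF⟩ := Ideal.Quotient.mk_surjective (s b)
  refine ⟨F, fun φ hφ ↦ ?_⟩
  let f : P →+* Trunc k m := φ.toRingHom.comp (algebraMap P B)
  have hf : ∀ a ∈ I, f a = 0 := by
    have h1 : RingHom.ker e ≤ (RingHom.ker (truncResidue k m : Trunc k m →+* k)).comap f :=
      fun a ha ↦ (hφ _).trans ha
    have h2 : I ≤ (RingHom.ker (truncResidue k m : Trunc k m →+* k) ^ N).comap f :=
      (Ideal.pow_right_mono h1 N).trans (Ideal.le_comap_pow f N)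
    intro a ha
    have := h2 ha
    rw [hN] at this
    exact this
  have key := lift_unique_of_formallyUnramified (P := P) (g₁ := φ.toRingHom)
    (g₂ := (Ideal.Quotient.lift I f hf).comp s) (r := (truncResidue k m : Trunc k m →+* k))
    ⟨N, hN⟩ (by
      rw [RingHom.comp_assoc, hs]
      exact RingHom.ext fun _ ↦ rfl) (by
      have : (truncResidue k m : Trunc k m →+* k).comp (Ideal.Quotient.lift I f hf) = r :=
        Ideal.Quotient.ringHom_ext (RingHom.ext fun a ↦ hφ _)
      rw [← RingHom.comp_assoc, this, hs']
      exact RingHom.ext hφ)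
  refine congr($key b).trans ?_
  rw [RingHom.comp_apply, ← hF]
  rfl

/-- Truncated arcs at a point of an étale extension of a polynomial ring. -/
theorem ringKrullDim_coordAlg_of_etale [Infinite k] [Algebra.Etale (MvPolynomial (Fin n) k) B]
    (ε : B →ₐ[k] k) {m : ℕ} {S : Type*} (ev : S → (B →ₐ[k] Trunc k m))
    (hε : ∀ s b, truncCoeff k 0 (ev s b) = ε b)
    (hsurj : ∀ φ : (∀ j, B →ₐ[k] Trunc k j),
      (∀ i j (h : i ≤ j), (truncMap k h).comp (φ j) = φ i) →
      (∀ j b, truncCoeff k 0 (φ j b) = ε b) → ∃ s, ev s = φ m) :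
    ringKrullDim (coordAlg ev) = (n * m : ℕ) := by
  have h := ringKrullDim_coordAlg_of_coordinates (ev := ev)
    (fun i : Fin n ↦ algebraMap (MvPolynomial (Fin n) k) B (.X i)) (fun i ↦ ⟨_, fun s ↦ hε s _⟩)
    (fun b ↦ ?_) fun c ↦ ?_
  · rwa [Nat.card_fin] at h
  · obtain ⟨F, hF⟩ := exists_polynomial_truncated_arc_eq (n := n) ε m b
    refine ⟨_, ?_, fun s ↦ hF (ev s) (hε s)⟩
    have h1 : F ∈ Algebra.adjoin k (Set.range (MvPolynomial.X : Fin n → MvPolynomial (Fin n) k)) :=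
      MvPolynomial.adjoin_range_X (R := k) (σ := Fin n) ▸ Algebra.mem_top
    have h2 := Subalgebra.mem_map.mpr
      ⟨F, h1, (rfl : IsScalarTower.toAlgHom k (MvPolynomial (Fin n) k) B F = algebraMap _ B F)⟩
    rw [AlgHom.map_adjoin, ← Set.range_comp] at h2
    exact h2
  · let f (i : Fin n) : Polynomial k :=
      .C (ε (algebraMap (MvPolynomial (Fin n) k) B (.X i))) +
        ∑ j : Fin m, .monomial (j + 1) (c (i, j))
    have hf (i : Fin n) : (f i).coeff 0 = ε (algebraMap (MvPolynomial (Fin n) k) B (.X i)) := by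
      simp [f, Polynomial.coeff_monomial]
    choose φ hφ hφε using fun j ↦ exists_truncated_arc (n := n) ε j
      (fun i ↦ AdjoinRoot.mk _ (f i)) (fun i ↦ (truncCoeff_mk 0 (f i)).trans (hf i))
    have hcomp (i j : ℕ) (h : i ≤ j) : (truncMap k h).comp (φ j) = φ i := by
      refine truncated_arc_unique (n := n) (fun l ↦ ?_) fun b ↦ ?_
      · rw [AlgHom.comp_apply, hφ, hφ, truncMap_mk]
      · rw [AlgHom.comp_apply, truncCoeff_truncMap, hφε]
        exact hφε j b
    obtain ⟨s, hs⟩ := hsurj φ hcomp hφε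
    refine ⟨s, fun i j ↦ ?_⟩
    rw [hs, hφ, truncCoeff_mk]
    simp [f, Polynomial.coeff_monomial, Fin.val_inj]

end EtaleCoordinates

/-! ### Arcs through a closed point, in general and on smooth varieties. -/

section Arcs

variable {k : Type u} [Field k] {X : Scheme.{u}} {p : X ⟶ Spec (CommRingCat.of k)} {m : ℕ}

theorem Arc.center_jet (γ : Arc p) (m : ℕ) : (γ.jet m).center = (γ.jet 0).center := by
  rw [← γ.compat 0 m (Nat.zero_le m), Jet.center_trunc]

theorem mem_arcFiber_iff {x : X} {γ : Arc p} : γ ∈ arcFiber p x ↔ (γ.jet 0).center = x :=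
  ⟨fun h ↦ h _, fun h s ↦ ((γ.jet 0).hom_apply s).trans h⟩

theorem jetImage_subset_jetsAt (x : X) (m : ℕ) : jetImage p x m ⊆ jetsAt p m x := by
  rintro _ ⟨γ, hγ, rfl⟩
  exact (γ.center_jet m).trans (mem_arcFiber_iff.mp hγ)

/-- The pullbacks of the sections over `U` along the `m`-jets of the arcs through a point of `U`. -/
noncomputable def jetImageEval {x : X} {U : X.Opens} (hxU : x ∈ U) (m : ℕ) (s : jetImage p x m) :
    Sections p U →ₐ[k] Trunc k m :=
  jetEval hxU ⟨s.1, jetImage_subset_jetsAt x m s.2⟩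

/-- The constant arc at a `k`-point. -/
noncomputable def Arc.const (σ : Spec (CommRingCat.of k) ⟶ X) (hσ : σ ≫ p = 𝟙 _) : Arc p where
  jet m :=
    { hom := Spec.map (CommRingCat.ofHom (algebraMap k (Trunc k m))) ≫ σ
      w := by rw [Category.assoc, hσ, Category.comp_id] }
  compat n m h := by
    ext1
    refine (Category.assoc _ _ _).symm.trans (congrArg (· ≫ σ) ?_)
    rw [← Spec.map_comp, ← CommRingCat.ofHom_comp]
    congr 2
    exact (truncMap k h).comp_algebraMap

theorem jetImage_nonempty [IsAlgClosed k] [LocallyOfFiniteType p] {x : X}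
    (hx : IsClosed ({x} : Set X)) (m : ℕ) : (jetImage p x m).Nonempty := by
  refine ⟨_, Arc.const (pointOfClosedPoint p x hx) (pointOfClosedPoint_comp p x hx), fun s ↦ ?_, rfl⟩
  exact (Scheme.Hom.comp_apply _ _ s).trans (pointOfClosedPoint_apply p x hx _)

/-- The arc corresponding to a compatible family of homomorphisms from the coordinate ring of an
affine open. -/
noncomputable def Arc.ofHom {U : X.Opens} (hU : IsAffineOpen U)
    (φ : ∀ m, Sections p U →ₐ[k] Trunc k m)
    (h : ∀ n m (h : n ≤ m), (truncMap k h).comp (φ m) = φ n) : Arc p where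
  jet m := Jet.ofHom hU (φ m)
  compat n m hnm := by rw [Jet.trunc_ofHom, h]

theorem Jet.center_eq_of_truncCoeff_eq {n : ℕ} {γ : Jet p m} {δ : Jet p n}
    (hδ : IsClosed ({δ.center} : Set X)) {U : X.Opens} (hU : IsAffineOpen U) (hγU : γ.LiesIn U)
    (hδU : δ.LiesIn U) (h : ∀ a, truncCoeff k 0 (γ.pullbackFun hγU a) =
      truncCoeff k 0 (δ.pullbackFun hδU a)) : γ.center = δ.center := by
  by_contra hne
  obtain ⟨f, hf, hγf⟩ := hU.exists_basicOpen_le (V := ⟨{δ.center}ᶜ, hδ.isOpen_compl⟩)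
    ⟨γ.center, hne⟩ (Jet.liesIn_iff.mp hγU)
  have h1 := (γ.center_mem_basicOpen_iff hγU f).mp hγf
  rw [h, ← δ.center_mem_basicOpen_iff hδU f] at h1
  exact hf h1 rfl

variable (p) in
/-- The dimension of the set of the `m`-jets of the arcs through a closed point can be computed on
any affine neighbourhood. -/
theorem topologicalKrullDim_closure_jetImage [IsAlgClosed k] [LocallyOfFiniteType p] {x : X}
    (hx : IsClosed ({x} : Set X)) {U : X.Opens} (hU : IsAffineOpen U) (hxU : x ∈ U) (m : ℕ) :
    topologicalKrullDim (closure (jetImage p x m)) =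
      ringKrullDim (coordAlg (jetImageEval (p := p) hxU m)) :=
  topologicalKrullDim_closure_eq hx hU hxU (jetImage_subset_jetsAt x m) (jetImage_nonempty hx m)

theorem exists_topologicalKrullDim_closure_jetImage_eq [IsAlgClosed k] [LocallyOfFiniteType p]
    {x : X} (hx : IsClosed ({x} : Set X)) (m : ℕ) :
    ∃ d : ℕ, topologicalKrullDim (closure (jetImage p x m)) = d := by
  obtain ⟨U, hU, hxU, -⟩ := exists_isAffineOpen_mem_and_subset (U := ⊤) (show x ∈ _ from trivial)
  have := finiteType_sections p hU
  have := (jetImage_nonempty (p := p) hx m).to_subtype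
  rw [topologicalKrullDim_closure_jetImage p hx hU hxU]
  exact exists_ringKrullDim_eq_natCast k _

variable (p) in
theorem exists_etale_sections [Smooth p] (x : X) : ∃ (U : X.Opens) (n : ℕ)
    (g : MvPolynomial (Fin n) k →+* Sections p U), IsAffineOpen U ∧ x ∈ U ∧
      g.comp MvPolynomial.C = algebraMap k (Sections p U) ∧ g.Etale := by
  obtain ⟨W, hW, U, hU, hxU, e, he⟩ := Smooth.exists_isStandardSmooth p x
  -- The base is a single point, so the nonempty open `W` is all of it.
  have hWtop : W = ⊤ := by
    ext s
    exact ⟨fun _ ↦ trivial, fun _ ↦ by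
      rw [Subsingleton.elim s (p x)]
      exact e hxU⟩
  subst hWtop
  have h2 : (sectionsBase p U).hom.IsStandardSmooth := by
    rw [sectionsBase, CommRingCat.hom_comp]
    exact RingHom.isStandardSmooth_respectsIso.2 _
      (Scheme.ΓSpecIso (CommRingCat.of k)).symm.commRingCatIsoToRingEquiv he
  obtain ⟨n, g, hg, hge⟩ := h2.exists_etale_mvPolynomial
  exact ⟨U, n, g, hU, hxU, hg, hge⟩

variable (p) in
/-- The dimension of the set of the `m`-jets of the arcs through a point of a smooth variety. -/
theorem topologicalKrullDim_closure_jetImage_of_smooth [IsAlgClosed k] [IsVariety p] [Smooth p]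
    {x : X} (hx : IsClosed ({x} : Set X)) (m : ℕ) :
    topologicalKrullDim (closure (jetImage p x m)) = (dim X * m : ℕ) := by
  obtain ⟨U, n, g, hU, hxU, hg, hge⟩ := exists_etale_sections p x
  have := IsVariety.locallyOfFiniteType (p := p)
  have : IsIntegral X := IsVariety.isIntegral p
  have : Nonempty U := ⟨⟨x, hxU⟩⟩
  have : IsDomain (Sections p U) := inferInstanceAs (IsDomain Γ(X, U))
  let := g.toAlgebra
  have : IsScalarTower k (MvPolynomial (Fin n) k) (Sections p U) := .of_algebraMap_eq' hg.symm
  have : Algebra.Etale (MvPolynomial (Fin n) k) (Sections p U) := hge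
  -- The number of étale coordinates is the transcendence degree of the function field.
  have hn : dim X = n := by
    have h1 := ringKrullDim_sections_eq_dim p hU
    rw [ringKrullDim_sections p hU hU, trdeg_of_etale_mvPolynomial n] at h1
    simpa using h1.symm
  obtain ⟨s₀, hs₀⟩ := jetImage_nonempty (p := p) hx 0
  let γ₀ : jetsAt p 0 x := ⟨s₀, jetImage_subset_jetsAt x 0 hs₀⟩
  let ε : Sections p U →ₐ[k] k := (truncResidue k 0).comp (jetEval hxU γ₀)
  rw [topologicalKrullDim_closure_jetImage p hx hU hxU, hn]
  refine ringKrullDim_coordAlg_of_etale ε _ (fun s b ↦ ?_) fun φ hφ hφε ↦ ?_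
  · exact Jet.truncCoeff_zero_eq_of_center_eq
      ((jetImage_subset_jetsAt x m s.2).trans γ₀.2.symm) _ _ b
  · have hc : ((Arc.ofHom hU φ hφ).jet 0).center = x := by
      have h0 : γ₀.1.center = x := γ₀.2
      refine (Jet.center_eq_of_truncCoeff_eq (δ := γ₀.1) (by rwa [h0]) hU (Jet.ofHom_liesIn hU _)
        (liesIn_of_mem_jetsAt γ₀.2 hxU) fun a ↦ ?_).trans h0
      refine Eq.trans ?_ (hφε 0 a)
      exact congrArg _ (Jet.pullbackFun_ofHom hU (φ 0) _ a)
    refine ⟨⟨_, Arc.ofHom hU φ hφ, mem_arcFiber_iff.mpr hc, rfl⟩, ?_⟩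
    ext1 a
    exact Jet.pullbackFun_ofHom hU (φ m) _ a

end Arcs

/-! ### Images of jets and arcs under morphisms. -/

section Functoriality

variable {k : Type u} [Field k] {X Z : Scheme.{u}} {p : X ⟶ Spec (CommRingCat.of k)}
  {r : Z ⟶ Spec (CommRingCat.of k)} {m : ℕ}

/-- The image of a jet under a morphism. -/
noncomputable def Jet.map (f : Z ⟶ X) (hf : f ≫ p = r) (γ : Jet r m) : Jet p m where
  hom := γ.hom ≫ f
  w := by rw [Category.assoc, hf, γ.w]

theorem Jet.center_map (f : Z ⟶ X) (hf : f ≫ p = r) (γ : Jet r m) :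
    (γ.map f hf).center = f γ.center :=
  Scheme.Hom.comp_apply _ _ _

/-- The image of an arc under a morphism. -/
noncomputable def Arc.map (f : Z ⟶ X) (hf : f ≫ p = r) (γ : Arc r) : Arc p where
  jet m := (γ.jet m).map f hf
  compat n m h := by
    rw [← γ.compat n m h]
    ext1
    exact (Category.assoc _ _ _).symm

theorem map_mem_jetImage (f : Z ⟶ X) (hf : f ≫ p = r) {z : Z} {γ : Jet r m}
    (hγ : γ ∈ jetImage r z m) : γ.map f hf ∈ jetImage p (f z) m := by
  obtain ⟨α, hα, rfl⟩ := hγ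
  refine ⟨α.map f hf, mem_arcFiber_iff.mpr ?_, rfl⟩
  exact ((α.jet 0).center_map f hf).trans (congrArg f (mem_arcFiber_iff.mp hα))

theorem sectionsBase_appLE (f : Z ⟶ X) (hf : f ≫ p = r) {U : X.Opens} {W : Z.Opens}
    (h : W ≤ f ⁻¹ᵁ U) : sectionsBase p U ≫ f.appLE U W h = sectionsBase r W := by
  subst hf
  rw [sectionsBase, Category.assoc, Scheme.Hom.appLE_comp_appLE, sectionsBase]

/-- The pullback of sections along a morphism over `k`. -/
noncomputable def sectionsPullback (f : Z ⟶ X) (hf : f ≫ p = r) {U : X.Opens} {W : Z.Opens}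
    (h : W ≤ f ⁻¹ᵁ U) : Sections p U →ₐ[k] Sections r W where
  __ := ((f.appLE U W h).hom : Γ(X, U) →+* Γ(Z, W))
  commutes' c := congr($(sectionsBase_appLE f hf h) c)

theorem Jet.pullbackFun_sectionsPullback (f : Z ⟶ X) (hf : f ≫ p = r) {U : X.Opens} {W : Z.Opens}
    (h : W ≤ f ⁻¹ᵁ U) (γ : Jet r m) (hW : γ.LiesIn W) (hU : (γ.map f hf).LiesIn U) (a : Γ(X, U)) :
    γ.pullbackFun hW (f.appLE U W h a) = (γ.map f hf).pullbackFun hU a :=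
  congr($(appLE_comp_specPullback γ.hom f h hW hU) a)

end Functoriality

/-! ### Arcs on the fibre product and the comparison of the two sequences. -/

section Product

variable {k : Type u} [Field k] {X Y : Scheme.{u}} (p : X ⟶ Spec (CommRingCat.of k))
  (q : Y ⟶ Spec (CommRingCat.of k))

variable {p q} in
/-- The jet of the product with given components. -/
noncomputable def Jet.pair {m : ℕ} (γ : Jet p m) (δ : Jet q m) : Jet (pullback.fst p q ≫ p) m where
  hom := pullback.lift γ.hom δ.hom (γ.w.trans δ.w.symm)
  w := by rw [pullback.lift_fst_assoc, γ.w]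

variable {p q} in
/-- The arc of the product with given components. -/
noncomputable def Arc.pair (γ : Arc p) (δ : Arc q) : Arc (pullback.fst p q ≫ p) where
  jet m := (γ.jet m).pair (δ.jet m)
  compat n m h := by
    rw [← γ.compat n m h, ← δ.compat n m h]
    ext1
    apply pullback.hom_ext
    · refine (Category.assoc _ _ _).trans ((congrArg _ (pullback.lift_fst _ _ _)).trans ?_)
      exact (pullback.lift_fst _ _ _).symm
    · refine (Category.assoc _ _ _).trans ((congrArg _ (pullback.lift_snd _ _ _)).trans ?_)
      exact (pullback.lift_snd _ _ _).symm

theorem Jet.map_fst_pair {m : ℕ} (γ : Jet p m) (δ : Jet q m) :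
    (γ.pair δ).map (pullback.fst p q) rfl = γ :=
  Jet.ext (pullback.lift_fst _ _ _)

theorem Jet.map_snd_pair {m : ℕ} (γ : Jet p m) (δ : Jet q m) :
    (γ.pair δ).map (pullback.snd p q) pullback.condition.symm = δ :=
  Jet.ext (pullback.lift_snd _ _ _)

variable [IsAlgClosed k] [LocallyOfFiniteType p] [LocallyOfFiniteType q]

theorem fromSpecResidueField_eq {x : X} (hx : IsClosed ({x} : Set X)) :
    X.fromSpecResidueField x = (X.fromSpecResidueField x ≫ p) ≫ pointOfClosedPoint p x hx := by
  rw [← SpecMap_residueFieldIsoBase_inv p x hx, pointOfClosedPoint, ← Category.assoc,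
    ← Spec.map_comp, Iso.hom_inv_id, Spec.map_id, Category.id_comp]

theorem exists_fromSpecResidueField_comp {Z : Scheme.{u}} (f : Z ⟶ X) {z : Z} {x : X}
    (hzx : f z = x) (hx : IsClosed ({x} : Set X)) :
    Z.fromSpecResidueField z ≫ f =
      (Z.fromSpecResidueField z ≫ f ≫ p) ≫ pointOfClosedPoint p x hx := by
  subst hzx
  have h := Scheme.Hom.SpecMap_residueFieldMap_fromSpecResidueField f z
  rw [← Category.assoc (Z.fromSpecResidueField z), ← h]
  refine (congrArg _ (fromSpecResidueField_eq p hx)).trans ?_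
  simp only [Category.assoc]

/-- The `k`-point of the product with given closed points as components. -/
noncomputable def pairPoint {x : X} (hx : IsClosed ({x} : Set X)) {y : Y}
    (hy : IsClosed ({y} : Set Y)) : Spec (CommRingCat.of k) ⟶ pullback p q :=
  pullback.lift (pointOfClosedPoint p x hx) (pointOfClosedPoint q y hy) (by
    rw [pointOfClosedPoint_comp, pointOfClosedPoint_comp])

variable {p q} in
-- Projections do not determine a point of a fibre product in general. Here $x$ and $y$ are
-- $k$-rational, so the residue field point at $z$ factors through the $k$-point $(x,y)$.
theorem eq_pairPoint {x : X} (hx : IsClosed ({x} : Set X)) {y : Y} (hy : IsClosed ({y} : Set Y))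
    {z : ↥(pullback p q)} (hzx : pullback.fst p q z = x) (hzy : pullback.snd p q z = y) :
    z = pairPoint p q hx hy (IsLocalRing.closedPoint k) := by
  have h : (pullback p q).fromSpecResidueField z =
      ((pullback p q).fromSpecResidueField z ≫ pullback.fst p q ≫ p) ≫ pairPoint p q hx hy := by
    apply pullback.hom_ext
    · rw [exists_fromSpecResidueField_comp p _ hzx hx, pairPoint, Category.assoc _ (pullback.lift _ _ _),
        pullback.lift_fst]
    · rw [exists_fromSpecResidueField_comp q _ hzy hy, pairPoint, Category.assoc _ (pullback.lift _ _ _),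
        pullback.lift_snd, pullback.condition]
  let s : ↥(Spec ((pullback p q).residueField z)) := IsLocalRing.closedPoint _
  refine ((pullback p q).fromSpecResidueField_apply z s).symm.trans ?_
  refine congr($h s).trans ((Scheme.Hom.comp_apply _ _ s).trans ?_)
  exact congrArg _ (Subsingleton.elim (α := PrimeSpectrum k) _ _)

variable {p q} in
theorem isClosed_singleton_of_fst_of_snd {z : ↥(pullback p q)}
    (hx : IsClosed ({pullback.fst p q z} : Set X))
    (hy : IsClosed ({pullback.snd p q z} : Set Y)) : IsClosed ({z} : Set ↥(pullback p q)) := by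
  have h : pairPoint p q hx hy ≫ pullback.fst p q ≫ p = 𝟙 _ := by
    rw [pairPoint, pullback.lift_fst_assoc, pointOfClosedPoint_comp]
  have := (pointEquivClosedPoint (pullback.fst p q ≫ p) ⟨pairPoint p q hx hy, h⟩).2
  rw [eq_pairPoint hx hy (z := z) rfl rfl]
  exact this

theorem topologicalKrullDim_closure_jetImage_prod {z : ↥(pullback p q)}
    (hx : IsClosed ({pullback.fst p q z} : Set X))
    (hy : IsClosed ({pullback.snd p q z} : Set Y)) (m : ℕ) :
    topologicalKrullDim (closure (jetImage (pullback.fst p q ≫ p) z m)) =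
      topologicalKrullDim (closure (jetImage p (pullback.fst p q z) m)) +
        topologicalKrullDim (closure (jetImage q (pullback.snd p q z) m)) := by
  obtain ⟨U, hU, hxU, -⟩ := exists_isAffineOpen_mem_and_subset (U := ⊤)
    (show pullback.fst p q z ∈ _ from trivial)
  obtain ⟨V, hV, hyV, -⟩ := exists_isAffineOpen_mem_and_subset (U := ⊤)
    (show pullback.snd p q z ∈ _ from trivial)
  have := finiteType_sections p hU
  have := finiteType_sections q hV
  have := (jetImage_nonempty (p := p) hx m).to_subtype
  have := (jetImage_nonempty (p := q) hy m).to_subtype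
  have hzW : z ∈ pullback.fst p q ⁻¹ᵁ U ⊓ pullback.snd p q ⁻¹ᵁ V := ⟨hxU, hyV⟩
  rw [topologicalKrullDim_closure_jetImage p hx hU hxU,
    topologicalKrullDim_closure_jetImage q hy hV hyV,
    topologicalKrullDim_closure_jetImage _ (isClosed_singleton_of_fst_of_snd hx hy)
      (isAffineOpen_fst_inf_snd p q hU hV) hzW]
  obtain ⟨e, he, he'⟩ := exists_sections_tensor_ringEquiv p q hU hV
  let β : Sections p U →ₐ[k] Sections (pullback.fst p q ≫ p) _ :=
    sectionsPullback (pullback.fst p q) rfl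
      (inf_le_left : pullback.fst p q ⁻¹ᵁ U ⊓ pullback.snd p q ⁻¹ᵁ V ≤ _)
  let β' : Sections q V →ₐ[k] Sections (pullback.fst p q ≫ p) _ :=
    sectionsPullback (pullback.snd p q) pullback.condition.symm
      (inf_le_right : pullback.fst p q ⁻¹ᵁ U ⊓ pullback.snd p q ⁻¹ᵁ V ≤ _)
  refine ringKrullDim_coordAlg_prod
    (fun s ↦ ⟨s.1.map (pullback.fst p q) rfl, map_mem_jetImage _ rfl s.2⟩)
    (fun s ↦ ⟨s.1.map (pullback.snd p q) pullback.condition.symm, map_mem_jetImage _ _ s.2⟩)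
    ?_ β β' ?_ ?_ ?_
  -- Two jets that lift to arcs are paired by pairing the arcs, so that the pair again lifts to an
  -- arc through $z$.
  · rintro ⟨_, α, hα, rfl⟩ ⟨_, α', hα', rfl⟩
    refine ⟨⟨_, α.pair α', mem_arcFiber_iff.mpr ?_, rfl⟩, ?_, ?_⟩
    · refine (eq_pairPoint hx hy ?_ ?_).trans (eq_pairPoint hx hy rfl rfl).symm
      · refine (Jet.center_map (pullback.fst p q) rfl _).symm.trans ?_
        exact (congrArg Jet.center (Jet.map_fst_pair p q _ _)).trans (mem_arcFiber_iff.mp hα)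
      · refine (Jet.center_map (pullback.snd p q) pullback.condition.symm _).symm.trans ?_
        exact (congrArg Jet.center (Jet.map_snd_pair p q _ _)).trans (mem_arcFiber_iff.mp hα')
    · exact Subtype.ext (Jet.map_fst_pair p q _ _)
    · exact Subtype.ext (Jet.map_snd_pair p q _ _)
  · refine eq_top_iff.mpr fun d _ ↦ ?_
    obtain ⟨t, rfl⟩ : ∃ t, (e t : Sections (pullback.fst p q ≫ p) _) = d := e.surjective d
    induction t using TensorProduct.induction_on with
    | zero =>
      rw [map_zero]
      exact Subalgebra.zero_mem _
    | tmul a b =>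
      have : (e (a ⊗ₜ b) : Sections (pullback.fst p q ≫ p) _) = β a * β' b := by
        rw [← mul_one a, ← one_mul b, ← Algebra.TensorProduct.tmul_mul_tmul, map_mul, he, he',
          mul_one, one_mul]
        rfl
      rw [this]
      exact Subalgebra.mul_mem _ (Algebra.subset_adjoin (.inl ⟨a, rfl⟩))
        (Algebra.subset_adjoin (.inr ⟨b, rfl⟩))
    | add t t' h h' =>
      rw [map_add]
      exact Subalgebra.add_mem _ (h trivial) (h' trivial)
  · exact fun s b ↦ Jet.pullbackFun_sectionsPullback _ rfl _ _ _ _ b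
  · exact fun s b ↦ Jet.pullbackFun_sectionsPullback _ pullback.condition.symm _ _ _ _ b

theorem lambdaSeq_prod_of_smooth {k : Type u} [Field k] [IsAlgClosed k] {X Y : Scheme.{u}}
    (p : X ⟶ Spec (CommRingCat.of k)) (q : Y ⟶ Spec (CommRingCat.of k)) [IsVariety p] [IsVariety q]
    [Smooth q] {z : ↥(pullback p q)} (hx : IsClosed ({pullback.fst p q z} : Set X))
    (hy : IsClosed ({pullback.snd p q z} : Set Y)) :
    lambdaSeq (pullback.fst p q ≫ p) z = lambdaSeq p (pullback.fst p q z) := by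
  have := IsVariety.locallyOfFiniteType (p := p)
  have := IsVariety.locallyOfFiniteType (p := q)
  have : Nonempty ↥(pullback p q) := ⟨z⟩
  ext m
  -- Finiteness matters: `dim` sends an infinite dimension to $0$ and would not be additive.
  obtain ⟨d, hd⟩ := exists_topologicalKrullDim_closure_jetImage_eq (p := p) hx m
  have h := topologicalKrullDim_closure_jetImage_prod p q hx hy m
  rw [hd, topologicalKrullDim_closure_jetImage_of_smooth q hy, ← Nat.cast_add] at h
  rw [lambdaSeq, lambdaSeq, dim_pullback, dim_eq_of_topologicalKrullDim_eq h,
    dim_eq_of_topologicalKrullDim_eq hd]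
  push_cast
  ring

end Product

end JetArc

theorem mainTheorem6 {k : Type u} [Field k] [IsAlgClosed k] {X Y : Scheme.{u}}
    (p : X ⟶ Spec (CommRingCat.of k)) (q : Y ⟶ Spec (CommRingCat.of k))
    [JetArc.IsVariety p] [JetArc.IsVariety q] [Smooth q]
    (x : X) (hx : IsClosed ({x} : Set X)) (y : Y) (hy : IsClosed ({y} : Set Y))
    (z : ↥(pullback p q)) (hzx : pullback.fst p q z = x) (hzy : pullback.snd p q z = y) :
    (∀ L : ℤ, JetArc.HasLambda (pullback.fst p q ≫ p) z L ↔ JetArc.HasLambda p x L) ∧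
      JetArc.lambda (pullback.fst p q ≫ p) z = JetArc.lambda p x := by
  subst hzx hzy
  have h := JetArc.lambdaSeq_prod_of_smooth p q hx hy
  exact ⟨fun L ↦ by rw [JetArc.HasLambda, JetArc.HasLambda, h],
    by rw [JetArc.lambda, JetArc.lambda, h]⟩
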